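/- **Setting.** Let $K,d\ge 1$ and $T\ge 2$. In rounds $t=1,\dots,T$ an environment chooses $\theta_{t,1},\dots,\theta_{t,K}\in\mathbb R^d$, possibly at random and depending on everything that happened in earlier rounds; a context $X_t\sim\mathcal D$ is drawn independently of the past and of $\theta_t$ and shown to the learner; the learner plays $A_t\in\{1,\dots,K\}$ and observes its loss $\ell_t(X_t,A_t)$, where $\ell_t(x,a)=\langle x,\theta_{t,a}\rangle$. Assume $\|X_t\|\le\sigma$, $\|\theta_{t,a}\|\le R$ and $0\le \ell_t(X_t,a)\le 1$ almost surely for all $a,t$ (nothing else is assumed on $\mathcal D$; in particular no log-concavity). Let $L_T=\mathbb E\sum_t\ell_t(X_t,A_t)$, let $L_T^*=\inf_\pi \mathbb E\sum_t \ell_t(X_t,\pi(X_t))$ over all measurable $\pi:\mathbb R^d\to\{1,\dots,K\}$, and let $R_T=L_T-L_T^*$ be the expected regret. **Algorithm (MYGA, Allen-Zhu, Bubeck and Li 2018).** There are $N$ experts; in round $t$ expert $e$ gives an advice $\xi_t^e$ in the probability simplex. Given $\eta,\gamma>0$, let $S=\{s\in(\gamma,\tfrac12]: 2Ts\in\mathbb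 N\}$ index auxiliary experts. All $N+|S|$ experts start with weight $1$. In round $t$, with weights $w$, let $v=\sum_e w(e)\xi^e_t/\sum_e w(e)$ (sum over the $N$ base experts), and let $M$ (the majority arms) be the shortest initial segment, in decreasing order of $v$, of $v$-mass at least $\tfrac12$. For a probability vector $q$ let $\mathcal T_s q$ be $q$ with all coordinates $i\notin M$ with $q(i)\le s$ set to $0$ and their mass moved to $M$ proportionally to $q$. Let $q_t$ solve $$q_t=\frac{\sum_e w(e)\xi_t^e+\sum_{s\in S}w(s)\,\mathcal T_s q_t}{\sum_e w(e)+\sum_{s\in S}w(s)}$$ (the solution with the smallest minority coordinates, say). The auxiliary expert $s$ has advice $\xi_t^s=\mathcal T_s q_t$, the arm is drawn from $p_t=\mathcal T_\gamma q_t$, and every weight is multiplied by $\exp(-\eta\langle \xi_t,\tilde\ell_t\rangle)$ for the advice $\xi_t$ of its expert, where $\tilde\ell_t(i)=\mathbf 1\{i=A_t\}\,\ell_t(X_t,A_t)/p_t(i)$. As in the original analysis, for a number $L\ge0$ MYGA is tuned with $\eta=c_1\min\{1/K,\sqrt{\log(N+T)/(KL)}\}$ and $\gamma=c_2\eta$.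 **Theorem 1.** There are absolute constants $c_1,c_2>0$ and, for all $\sigma,R>0$, a constant $C$ depending only on $\sigma,R$, such that the following holds for all $K,d\ge1$, $T\ge2$. Let $B=\{\beta\in(\mathbb R^d)^K:\max_a\|\beta_a\|\le RT\}$ be the set of parameters of the linear classifiers $\pi_\beta(x)=\arg\min_a\langle x,\beta_a\rangle$, with the distance $\max_a\|\beta_a-\beta_a'\|$. 1. $B$ has a $\tfrac{K^2d}{2}$-cover $\beta^1,\dots,\beta^N$ with $\big(\tfrac{2RT}{K^2d}\big)^{Kd}\le N\le \max\{1,\tfrac{6RT}{K^2d}\}^{Kd}$, that is, with $\Theta\big(\tfrac{T}{K^2d}\big)^{Kd}$ elements. 2. Let $\beta^1,\dots,\beta^N$ be any $\tfrac{K^2d}{2}$-cover of $B$ with $N\le \max\{1,\tfrac{6RT}{K^2d}\}^{Kd}$. Suppose that the learner runs MYGA on the $N$ experts $\pi_{\beta^j}$, tuned with $L$. If $L_T^*\le L$, then $$R_T\le C\Big(K\sqrt{d\,L\,\log T}+K^2d\log T\Big).$$ In particular, if MYGA is tuned with $L=L_T^*$, then $R_T=O\big(K\sqrt{dL_T^*\log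 T}+K^2d\log T\big)$. -/

import Mathlib

open MeasureTheory ProbabilityTheory

/-! ### The MYGA algorithm for bandits with expert advice

`N` experts give advice `ξ e` (a probability vector on the `K` arms). Besides the `N` base experts
the algorithm maintains one auxiliary expert for every threshold `s` in a finite grid. -/

/-- The thresholds of the auxiliary experts: the numbers `s ∈ (γ, 1/2]` with `2 T s ∈ ℕ`. -/
noncomputable def mygaThresholds (T : ℕ) (γ : ℝ) : Finset ℝ :=
  ((Finset.Icc 1 T).image (fun m : ℕ => (m : ℝ) / (2 * T))).filter (fun s => γ < s)

/-- Unnormalized weights of the base experts and of the auxiliary experts. -/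
structure MygaWeights (N : ℕ) where
  base : Fin N → ℝ
  aux : ℝ → ℝ

/-- The weighted average of the advice of the base experts. -/
noncomputable def baseMix {N K : ℕ} (w : MygaWeights N) (ξ : Fin N → Fin K → ℝ) : Fin K → ℝ :=
  fun i => (∑ e, w.base e * ξ e i) / ∑ e, w.base e

/-- The majority arms of a probability vector `v`: list the arms by decreasing probability (ties
by index) and take the shortest initial segment of total mass at least `1/2`. An arm belongs to it
iff the arms listed strictly before have total mass less than `1/2`. -/
noncomputable def majorityArms {K : ℕ} (v : Fin K → ℝ) : Finset (Fin K) :=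
  Finset.univ.filter fun i =>
    ∑ j ∈ Finset.univ.filter (fun j => v i < v j ∨ (v i = v j ∧ j < i)), v j < 1 / 2

/-- Truncation at level `s`: minority arms (those outside `M`) of probability at most `s` get
probability `0`, and their mass is moved to the majority arms `M`, proportionally. -/
noncomputable def truncArms {K : ℕ} (M : Finset (Fin K)) (s : ℝ) (q : Fin K → ℝ) : Fin K → ℝ :=
  fun i =>
    if i ∈ M then
      q i * (1 + (∑ j ∈ Finset.univ.filter (fun j => j ∉ M ∧ q j ≤ s), q j) / ∑ j ∈ M, q j)
    else if q i ≤ s then 0 else q i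

/-- The `i`-th coordinate, for a minority arm `i`, of the self-consistent mixture below: the
smallest solution `x` of
`x * (total weight) = ∑ e, w e * ξ e i + ∑ {s ∈ S, s < x}, w s * x`. -/
noncomputable def minoritySol {N K : ℕ} (S : Finset ℝ) (w : MygaWeights N)
    (ξ : Fin N → Fin K → ℝ) (i : Fin K) : ℝ :=
  sInf {x : ℝ | 0 ≤ x ∧ x * (∑ e, w.base e + ∑ s ∈ S, w.aux s) =
    ∑ e, w.base e * ξ e i + ∑ s ∈ S.filter (fun s => s < x), w.aux s * x}

/-- The self-consistent mixture `q`: the probability vector for which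
`q = (∑ e, w e * ξ e + ∑ s ∈ S, w s * (truncation of q at level s)) / (total weight)`,
the majority arms being those of the base mixture (see `mygaMix_eq`). -/
noncomputable def mygaMix {N K : ℕ} (S : Finset ℝ) (w : MygaWeights N)
    (ξ : Fin N → Fin K → ℝ) : Fin K → ℝ :=
  fun i =>
    if i ∈ majorityArms (baseMix w ξ) then
      baseMix w ξ i *
        ((1 - ∑ j ∈ Finset.univ.filter (fun j => j ∉ majorityArms (baseMix w ξ)),
            minoritySol S w ξ j) /
          ∑ j ∈ majorityArms (baseMix w ξ), baseMix w ξ j)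
    else minoritySol S w ξ i

/-- The equation that defines `minoritySol` has a smallest nonnegative solution. -/
theorem minoritySol_spec {N K : ℕ} (S : Finset ℝ) (w : MygaWeights N)
    (ξ : Fin N → Fin K → ℝ) (i : Fin K) (hw : 0 < ∑ e, w.base e) (haux : ∀ s ∈ S, 0 ≤ w.aux s)
    (hξ : 0 ≤ ∑ e, w.base e * ξ e i) :
    IsLeast {x : ℝ | 0 ≤ x ∧ x * (∑ e, w.base e + ∑ s ∈ S, w.aux s) =
      ∑ e, w.base e * ξ e i + ∑ s ∈ S.filter (fun s => s < x), w.aux s * x}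
      (minoritySol S w ξ i) := by
  set B := ∑ e, w.base e with hB
  set c := ∑ e, w.base e * ξ e i with hc
  set g : ℝ → ℝ := fun x => B + ∑ s ∈ S.filter (fun s => ¬ s < x), w.aux s with hg
  have hgpos : ∀ x, 0 < g x := fun x =>
    add_pos_of_pos_of_nonneg hw (Finset.sum_nonneg fun s hs => haux s (Finset.mem_filter.1 hs).1)
  have hganti : ∀ x y, x ≤ y → g y ≤ g x := by
    intro x y hxy
    refine add_le_add le_rfl (Finset.sum_le_sum_of_subset_of_nonneg ?_ ?_)
    · intro s hs
      rw [Finset.mem_filter] at hs ⊢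
      exact ⟨hs.1, fun h => hs.2 (h.trans_le hxy)⟩
    · intro s hs _
      exact haux s (Finset.mem_filter.1 hs).1
  have hiff : ∀ x : ℝ, (x * (B + ∑ s ∈ S, w.aux s) =
      c + ∑ s ∈ S.filter (fun s => s < x), w.aux s * x) ↔ x * g x = c := by
    intro x
    have := Finset.sum_filter_add_sum_filter_not S (fun s => s < x) w.aux
    rw [← this, ← Finset.sum_mul]
    simp only [hg]
    constructor <;> intro h <;> linarith
  have hset : {x : ℝ | 0 ≤ x ∧ x * (B + ∑ s ∈ S, w.aux s) =
      c + ∑ s ∈ S.filter (fun s => s < x), w.aux s * x} = {x : ℝ | 0 ≤ x ∧ x * g x = c} := by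
    ext x
    simp only [Set.mem_ofPred_eq, hiff]
  have hm : minoritySol S w ξ i = sInf {x : ℝ | 0 ≤ x ∧ x * g x = c} := by
    rw [← hset]; rfl
  rw [hset, hm]
  have hfin : {x : ℝ | 0 ≤ x ∧ x * g x = c}.Finite := by
    refine (S.powerset.image (fun U => c / (B + ∑ s ∈ U, w.aux s))).finite_toSet.subset ?_
    rintro x ⟨-, hx⟩
    simp only [Finset.coe_image, Set.mem_image, Finset.mem_coe, Finset.mem_powerset]
    refine ⟨S.filter (fun s => ¬ s < x), Finset.filter_subset _ _, ?_⟩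
    change c / g x = x
    rw [← hx]
    field_simp [(hgpos x).ne']
  have hne : {x : ℝ | 0 ≤ x ∧ x * g x = c}.Nonempty := by
    set V : Set ℝ := {x | 0 ≤ x ∧ c ≤ x * g x} with hV
    have hVb : BddBelow V := ⟨0, fun x hx => hx.1⟩
    have hVn : V.Nonempty := by
      refine ⟨c / B, div_nonneg hξ hw.le, ?_⟩
      have h1 : B ≤ g (c / B) :=
        le_add_of_nonneg_right
          (Finset.sum_nonneg fun s hs => haux s (Finset.mem_filter.1 hs).1)
      calc c = c / B * B := by field_simp
        _ ≤ _ := mul_le_mul_of_nonneg_left h1 (div_nonneg hξ hw.le)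
    set x₀ := sInf V with hx₀
    have h0 : 0 ≤ x₀ := le_csInf hVn fun x hx => hx.1
    have hdiv : c / g x₀ * g x₀ = c := div_mul_cancel₀ _ (hgpos x₀).ne'
    refine ⟨x₀, h0, le_antisymm ?_ ?_⟩
    · by_contra! h
      have hlt : c / g x₀ < x₀ := by rwa [div_lt_iff₀ (hgpos x₀)]
      have hmem : c / g x₀ ∈ V := by
        refine ⟨div_nonneg hξ (hgpos x₀).le, ?_⟩
        calc c = c / g x₀ * g x₀ := hdiv.symm
          _ ≤ _ := mul_le_mul_of_nonneg_left (hganti _ _ hlt.le)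
            (div_nonneg hξ (hgpos x₀).le)
      exact absurd (csInf_le hVb hmem) (not_le.2 hlt)
    · by_contra! h
      have hlt : x₀ < c / g x₀ := by rwa [lt_div_iff₀ (hgpos x₀)]
      have hle : c / g x₀ ≤ x₀ := by
        refine le_csInf hVn fun x hx => ?_
        rw [div_le_iff₀ (hgpos x₀)]
        exact hx.2.trans (mul_le_mul_of_nonneg_left (hganti _ _ (csInf_le hVb hx)) hx.1)
      exact absurd hle (not_le.2 hlt)
  exact ⟨hne.csInf_mem hfin, fun x hx => csInf_le ⟨0, fun y hy => hy.1⟩ hx⟩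

/-- The mixture `mygaMix` solves its self-consistency equation. -/
theorem mygaMix_eq {N K : ℕ} (S : Finset ℝ) (w : MygaWeights N)
    (ξ : Fin N → Fin K → ℝ) (hw : 0 < ∑ e, w.base e) (hbase : ∀ e, 0 ≤ w.base e)
    (haux : ∀ s ∈ S, 0 ≤ w.aux s) (hξ : ∀ e i, 0 ≤ ξ e i) (hξ1 : ∀ e, ∑ i, ξ e i = 1)
    (i : Fin K) :
    mygaMix S w ξ i = (∑ e, w.base e * ξ e i + ∑ s ∈ S, w.aux s *
      truncArms (majorityArms (baseMix w ξ)) s (mygaMix S w ξ) i) /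
        (∑ e, w.base e + ∑ s ∈ S, w.aux s) := by
  have hW : 0 < ∑ e, w.base e + ∑ s ∈ S, w.aux s :=
    add_pos_of_pos_of_nonneg hw (Finset.sum_nonneg haux)
  have hc : ∀ i, 0 ≤ ∑ e, w.base e * ξ e i := fun i =>
    Finset.sum_nonneg fun e _ => mul_nonneg (hbase e) (hξ e i)
  have hv : ∀ i, baseMix w ξ i * ∑ e, w.base e = ∑ e, w.base e * ξ e i := fun i =>
    div_mul_cancel₀ _ hw.ne'
  have hv0 : ∀ i, 0 ≤ baseMix w ξ i := fun i => div_nonneg (hc i) hw.le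
  have hv1 : ∑ i, baseMix w ξ i = 1 := by
    have : (∑ i, baseMix w ξ i) * ∑ e, w.base e = 1 * ∑ e, w.base e := by
      rw [Finset.sum_mul, Finset.sum_congr rfl fun i _ => hv i, Finset.sum_comm, one_mul]
      exact Finset.sum_congr rfl fun e _ => by rw [← Finset.mul_sum, hξ1, mul_one]
    exact mul_right_cancel₀ hw.ne' this
  set v := baseMix w ξ with hvdef
  set M := majorityArms v with hM
  set q := mygaMix S w ξ with hq
  have hqn : ∀ j, j ∉ M → q j = minoritySol S w ξ j := fun j hj => by
    simp only [hq, mygaMix]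
    exact if_neg hj
  set Qn := ∑ j ∈ Finset.univ.filter (fun j => j ∉ M), q j with hQn
  have hqm : ∀ j, j ∈ M → q j = v j * ((1 - Qn) / ∑ j ∈ M, v j) := fun j hj => by
    have : Qn = ∑ j ∈ Finset.univ.filter (fun j => j ∉ M), minoritySol S w ξ j :=
      Finset.sum_congr rfl fun j hj => hqn j (Finset.mem_filter.1 hj).2
    rw [this]
    simp only [hq, mygaMix]
    exact if_pos hj
  have hneg : ∀ j, j ∉ M → q j * (∑ e, w.base e + ∑ s ∈ S, w.aux s) =
      ∑ e, w.base e * ξ e j + ∑ s ∈ S, w.aux s * truncArms M s q j := by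
    intro j hj
    have h := (minoritySol_spec S w ξ j hw haux (hc j)).1.2
    rw [hqn j hj, h, Finset.sum_filter]
    congr 1
    refine Finset.sum_congr rfl fun s _ => ?_
    rw [truncArms, if_neg hj, hqn j hj]
    by_cases hs : s < minoritySol S w ξ j
    · rw [if_pos hs, if_neg (not_le.2 hs)]
    · rw [if_neg hs, if_pos (not_lt.1 hs), mul_zero]
  rw [eq_div_iff hW.ne']
  by_cases hi : i ∈ M
  swap
  · exact hneg i hi
  -- the majority arms have positive base mass
  have hVpos : 0 < ∑ j ∈ M, v j := by
    have hne : (Finset.univ : Finset (Fin K)).Nonempty := ⟨i, Finset.mem_univ i⟩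
    obtain ⟨m, -, hmax⟩ := Finset.exists_max_image Finset.univ v hne
    obtain ⟨m', hm', hmin⟩ := Finset.exists_min_image
      (Finset.univ.filter fun j => v j = v m) id ⟨m, by simp⟩
    have hm'v : v m' = v m := (Finset.mem_filter.1 hm').2
    have hmem : m' ∈ M := by
      rw [hM, majorityArms, Finset.mem_filter]
      refine ⟨Finset.mem_univ _, ?_⟩
      rw [Finset.filter_false_of_mem, Finset.sum_empty]
      · norm_num
      · rintro j - (h | ⟨h1, h2⟩)
        · have := hmax j (Finset.mem_univ j)
          linarith
        · have : m' ≤ j := hmin j (by simp [← h1, hm'v])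
          exact absurd h2 (not_lt.2 this)
    have hpos : 0 < v m' := by
      rw [hm'v]
      by_contra! h
      have : ∑ i, v i ≤ 0 := Finset.sum_nonpos fun j hj => (hmax j hj).trans h
      linarith
    exact hpos.trans_le (Finset.single_le_sum (fun j _ => hv0 j) hmem)
  set V := ∑ j ∈ M, v j with hV
  have hQm : ∑ j ∈ M, q j = 1 - Qn := by
    rw [Finset.sum_congr rfl hqm, ← Finset.sum_mul, ← hV, mul_div_cancel₀ _ hVpos.ne']
  have hVn : ∑ j ∈ Finset.univ.filter (fun j => j ∉ M), v j = 1 - V := by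
    have h := Finset.sum_filter_add_sum_filter_not Finset.univ (fun j => j ∈ M) v
    rw [hv1, Finset.filter_mem_eq_inter, Finset.univ_inter] at h
    linarith
  -- a minority arm has less mass in the mixture than in the base mixture
  have hle : ∀ j, j ∉ M → q j ≤ v j := by
    intro j hj
    have h := hneg j hj
    have h0 : 0 ≤ q j := by
      rw [hqn j hj]
      exact (minoritySol_spec S w ξ j hw haux (hc j)).1.1
    have h1 : ∑ s ∈ S, w.aux s * truncArms M s q j ≤ (∑ s ∈ S, w.aux s) * q j := by
      rw [Finset.sum_mul]
      refine Finset.sum_le_sum fun s hs => mul_le_mul_of_nonneg_left ?_ (haux s hs)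
      rw [truncArms, if_neg hj]
      split_ifs
      · exact h0
      · exact le_rfl
    rw [← hv j] at h
    have : q j * ∑ e, w.base e ≤ v j * ∑ e, w.base e := by linarith
    exact le_of_mul_le_mul_right this hw
  have hQpos : 0 < 1 - Qn := by
    have : Qn ≤ 1 - V := by
      rw [← hVn]
      exact Finset.sum_le_sum fun j hj => hle j (Finset.mem_filter.1 hj).2
    linarith
  have hsmall : ∀ s, ∑ j ∈ Finset.univ.filter (fun j => j ∉ M ∧ q j ≤ s), q j =
      Qn - ∑ j ∈ Finset.univ.filter (fun j => j ∉ M), truncArms M s q j := by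
    intro s
    rw [hQn, ← Finset.sum_sub_distrib, ← Finset.filter_filter, Finset.sum_filter]
    refine Finset.sum_congr rfl fun j hj => ?_
    rw [truncArms, if_neg (Finset.mem_filter.1 hj).2]
    split_ifs <;> ring
  -- sum of the equations of the minority arms
  have hsum : Qn * (∑ e, w.base e + ∑ s ∈ S, w.aux s) = (1 - V) * ∑ e, w.base e +
      ∑ s ∈ S, w.aux s * ∑ j ∈ Finset.univ.filter (fun j => j ∉ M), truncArms M s q j := by
    rw [hQn, Finset.sum_mul, Finset.sum_congr rfl fun j hj => hneg j (Finset.mem_filter.1 hj).2,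
      Finset.sum_add_distrib, Finset.sum_comm (s := Finset.univ.filter (fun j => j ∉ M)) (t := S),
      ← hVn, Finset.sum_mul]
    congr 1
    · exact Finset.sum_congr rfl fun j _ => (hv j).symm
    · exact Finset.sum_congr rfl fun s _ => (Finset.mul_sum _ _ _).symm
  have htr : ∀ s, truncArms M s q i = v i / V * (1 -
      ∑ j ∈ Finset.univ.filter (fun j => j ∉ M), truncArms M s q j) := by
    intro s
    conv_lhs => rw [truncArms, if_pos hi, hQm, hsmall s, hqm i hi]
    field_simp
    ring
  have htot : ∑ s ∈ S, w.aux s * truncArms M s q i = v i / V * (∑ s ∈ S, w.aux s -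
      ∑ s ∈ S, w.aux s * ∑ j ∈ Finset.univ.filter (fun j => j ∉ M), truncArms M s q j) := by
    rw [← Finset.sum_sub_distrib, Finset.mul_sum]
    exact Finset.sum_congr rfl fun s _ => by rw [htr s]; ring
  rw [htot, hqm i hi, ← hv i]
  field_simp
  linear_combination (-v i) * hsum

/-- The advice of the auxiliary expert with threshold `s`. -/
noncomputable def mygaAux {N K : ℕ} (T : ℕ) (γ s : ℝ) (w : MygaWeights N)
    (ξ : Fin N → Fin K → ℝ) : Fin K → ℝ :=
  truncArms (majorityArms (baseMix w ξ)) s (mygaMix (mygaThresholds T γ) w ξ)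

/-- The distribution from which MYGA draws its arm: the mixture truncated at level `γ`. -/
noncomputable def mygaPlay {N K : ℕ} (T : ℕ) (γ : ℝ) (w : MygaWeights N)
    (ξ : Fin N → Fin K → ℝ) : Fin K → ℝ :=
  mygaAux T γ γ w ξ

/-- The weights of MYGA before round `t` (rounds are numbered from `0`), for the advice `ξ`, the
played arms `A` and the observed losses `y`: uniform initial weights and exponential updates with
the importance weighted loss estimates `i ↦ 1{i = A t} * y t / p t (A t)`. -/
noncomputable def mygaWeights {N K : ℕ} (T : ℕ) (η γ : ℝ) (ξ : ℕ → Fin N → Fin K → ℝ)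
    (A : ℕ → Fin K) (y : ℕ → ℝ) : ℕ → MygaWeights N
  | 0 => ⟨fun _ => 1, fun _ => 1⟩
  | t + 1 =>
    let w := mygaWeights T η γ ξ A y t
    let est := y t / mygaPlay T γ w (ξ t) (A t)
    ⟨fun e => w.base e * Real.exp (-η * (ξ t e (A t) * est)),
     fun s => w.aux s * Real.exp (-η * (mygaAux T γ s w (ξ t) (A t) * est))⟩

/-- The distribution of the arm that MYGA plays in round `t`. It depends only on the advice up to
round `t` and on the arms and losses observed before round `t`. -/
noncomputable def mygaProb {N K : ℕ} (T : ℕ) (η γ : ℝ) (ξ : ℕ → Fin N → Fin K → ℝ)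
    (A : ℕ → Fin K) (y : ℕ → ℝ) (t : ℕ) : Fin K → ℝ :=
  mygaPlay T γ (mygaWeights T η γ ξ A y t) (ξ t)

/-- The learning rate `a * min (1 / K) (sqrt (log (N + T) / (K * L)))`, written so that it is also
meaningful for `L = 0`, where it is `a / K`. -/
noncomputable def mygaRate (a : ℝ) (K T N : ℕ) (L : ℝ) : ℝ :=
  a * Real.sqrt (Real.log (N + T) / (K * max L (K * Real.log (N + T))))

/-! ### Linear classifiers -/

/-- The linear classifier `π_β (x) = argmin_a ⟨x, β_a⟩`, ties broken by the smallest index. -/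
noncomputable def linClassifier {K d : ℕ} [NeZero K] (β : Fin K → EuclideanSpace ℝ (Fin d))
    (x : EuclideanSpace ℝ (Fin d)) : Fin K :=
  (Finset.univ.filter fun a => ∀ b, inner ℝ x (β a) ≤ inner ℝ x (β b)).min' (by
    obtain ⟨a, ha⟩ := Finite.exists_min fun a => inner ℝ x (β a)
    exact ⟨a, by simpa using ha⟩)

/-- The advice of an expert that follows the linear classifier `π_β`: a point mass. -/
noncomputable def classifierAdvice {K d : ℕ} [NeZero K] (β : Fin K → EuclideanSpace ℝ (Fin d))
    (x : EuclideanSpace ℝ (Fin d)) : Fin K → ℝ :=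
  Pi.single (linClassifier β x) 1

/-- The finite family `β` is an `ε`-cover of `{b : max_a ‖b_a‖ ≤ ρ}` for the distance
`max_a ‖b_a - b'_a‖`. -/
def IsParamCover {K d N : ℕ} (ρ ε : ℝ) (β : Fin N → Fin K → EuclideanSpace ℝ (Fin d)) : Prop :=
  ∀ b : Fin K → EuclideanSpace ℝ (Fin d), (∀ a, ‖b a‖ ≤ ρ) →
    ∃ j, ∀ a, ‖b a - β j a‖ ≤ ε

/-! ### The adversarial linear contextual bandit -/

/-- The loss `ℓ_t(X_t, a) = ⟨X_t, θ_{t,a}⟩`. -/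
noncomputable def banditLoss {Ω : Type*} {K d : ℕ} (X : ℕ → Ω → EuclideanSpace ℝ (Fin d))
    (θ : ℕ → Ω → Fin K → EuclideanSpace ℝ (Fin d)) (t : ℕ) (ω : Ω) (a : Fin K) : ℝ :=
  inner ℝ (X t ω) (θ t ω a)

/-- Everything that happened before round `t`: contexts, parameters and arms. -/
def banditHistory {Ω : Type*} {K d : ℕ} (X : ℕ → Ω → EuclideanSpace ℝ (Fin d))
    (θ : ℕ → Ω → Fin K → EuclideanSpace ℝ (Fin d)) (A : ℕ → Ω → Fin K) (t : ℕ) (ω : Ω) :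
    Fin t → EuclideanSpace ℝ (Fin d) × (Fin K → EuclideanSpace ℝ (Fin d)) × Fin K :=
  fun s => (X s ω, θ s ω, A s ω)

/-- `T` rounds of interaction (numbered `0, …, T - 1`) between an adaptive randomized environment,
which chooses `θ t`, i.i.d. contexts `X t` of law `D`, and a learner, which in round `t` draws its
arm `A t` from the distribution `p t`. -/
structure IsBanditInteraction {Ω : Type*} [MeasurableSpace Ω] {K d : ℕ} (T : ℕ)
    (D : Measure (EuclideanSpace ℝ (Fin d))) (μ : Measure Ω)
    (X : ℕ → Ω → EuclideanSpace ℝ (Fin d)) (θ : ℕ → Ω → Fin K → EuclideanSpace ℝ (Fin d))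
    (A : ℕ → Ω → Fin K) (p : ℕ → Ω → Fin K → ℝ) : Prop where
  measurable_context : ∀ t < T, Measurable (X t)
  measurable_param : ∀ t < T, Measurable (θ t)
  measurable_arm : ∀ t < T, Measurable (A t)
  /-- the contexts have law `D` -/
  context_law : ∀ t < T, μ.map (X t) = D
  /-- the context of round `t` is independent of the past and of the parameters of round `t`;
  the latter may depend on the past and on further randomness in any way -/
  context_indep : ∀ t < T, IndepFun (X t) (fun ω => (banditHistory X θ A t ω, θ t ω)) μ
  /-- given the past, the parameters and the context of round `t`, the arm has law `p t` -/
  arm_law : ∀ t < T, ∀ a : Fin K,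
    μ[(A t ⁻¹' {a}).indicator (fun _ => (1 : ℝ)) |
        MeasurableSpace.comap (fun ω => (banditHistory X θ A t ω, θ t ω, X t ω)) inferInstance]
      =ᵐ[μ] fun ω => p t ω a

/-- The play distributions of MYGA run on the experts `π_{β j}`, `j : Fin N`, in the bandit. -/
noncomputable def mygaLearner {Ω : Type*} {K d N : ℕ} [NeZero K] (T : ℕ) (η γ : ℝ)
    (β : Fin N → Fin K → EuclideanSpace ℝ (Fin d)) (X : ℕ → Ω → EuclideanSpace ℝ (Fin d))
    (θ : ℕ → Ω → Fin K → EuclideanSpace ℝ (Fin d)) (A : ℕ → Ω → Fin K) :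
    ℕ → Ω → Fin K → ℝ :=
  fun t ω => mygaProb T η γ (fun s j => classifierAdvice (β j) (X s ω)) (fun s => A s ω)
    (fun s => banditLoss X θ s ω (A s ω)) t

/-- The expected cumulative loss `L_T` of the learner. -/
noncomputable def learnerLoss {Ω : Type*} [MeasurableSpace Ω] {K d : ℕ} (T : ℕ) (μ : Measure Ω)
    (X : ℕ → Ω → EuclideanSpace ℝ (Fin d)) (θ : ℕ → Ω → Fin K → EuclideanSpace ℝ (Fin d))
    (A : ℕ → Ω → Fin K) : ℝ :=
  ∫ ω, ∑ t ∈ Finset.range T, banditLoss X θ t ω (A t ω) ∂μ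

/-- The expected cumulative loss `L_T^π` of a stationary deterministic policy `π`. -/
noncomputable def policyLoss {Ω : Type*} [MeasurableSpace Ω] {K d : ℕ} (T : ℕ) (μ : Measure Ω)
    (X : ℕ → Ω → EuclideanSpace ℝ (Fin d)) (θ : ℕ → Ω → Fin K → EuclideanSpace ℝ (Fin d))
    (π : EuclideanSpace ℝ (Fin d) → Fin K) : ℝ :=
  ∫ ω, ∑ t ∈ Finset.range T, banditLoss X θ t ω (π (X t ω)) ∂μ

/-- The optimal loss `L_T^* = min_π L_T^π` over all (measurable) policies. -/
noncomputable def optLoss {Ω : Type*} [MeasurableSpace Ω] {K d : ℕ} (T : ℕ) (μ : Measure Ω)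
    (X : ℕ → Ω → EuclideanSpace ℝ (Fin d)) (θ : ℕ → Ω → Fin K → EuclideanSpace ℝ (Fin d)) : ℝ :=
  ⨅ π : {π : EuclideanSpace ℝ (Fin d) → Fin K // Measurable π}, policyLoss T μ X θ π.1

/-- The expected regret `R_T = L_T - L_T^*`. -/
noncomputable def expectedRegret {Ω : Type*} [MeasurableSpace Ω] {K d : ℕ} (T : ℕ)
    (μ : Measure Ω) (X : ℕ → Ω → EuclideanSpace ℝ (Fin d))
    (θ : ℕ → Ω → Fin K → EuclideanSpace ℝ (Fin d)) (A : ℕ → Ω → Fin K) : ℝ :=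
  learnerLoss T μ X θ A - optLoss T μ X θ

/-! Two independent facts are combined.

Geometry. The context of a round is independent of its parameters, so a fixed policy `π` has loss `∫
⟨x, b (π x)⟩ ∂D`, where `b a` is the sum over the rounds of the expectations of `θ t a`, a vector of
norm at most `R * T`. An optimal policy therefore minimizes `⟨x, b a⟩` pointwise. If a cover element
is within `ε` of `b`, every score `⟨x, b a⟩` changes by at most `σ * ε`, so its classifier loses at
most `2 * σ * ε` against any policy, without any assumption on margins or densities. With `ε = K² d
/ 2` this is of the order of the second term of the bound, and the logarithm of the number of
experts is of order `K * d * log T` (`exists_linClassifier_policyLoss_le`, `log_add_le_of_card_le`).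

Algorithm. Let `z t` be the loss of round `t` divided by the probability of the played arm, `Z` the
sum of the `z t`, and `Y` the realized loss. By self-consistency the mixture `q` is the weighted
average of all advice, so exponential weights have regret at most `log (N + T) / η + η / 2 * Z`
against each base and each auxiliary expert (`sum_sub_mul_mygaEst_le`). A first-order bound requires
`Z` to be controlled by `K * Y`. On a majority arm this is clear, since its probability is at least
`1 / (2 * K)`. On a minority arm `i`, the regret against threshold `s` contains `q i * z` exactly
when `q i ≤ s`; averaging over `s` with coefficients whose tail sums from `x` are comparable with `1
/ x` recovers `z` up to a factor `2`. Hence the regret against the auxiliary experts bounds `Z` by a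
multiple of `K * Y`, a logarithmic term and `Z / 2`, which is absorbed (`est_le`, `sum_mygaEst_le`).

The resulting inequality is pathwise. Taking expectations, the importance weighted loss of an expert
is at most its true loss (`integral_advice_mul_div_le`), and the choice of the rate balances the
terms. -/

/-! ### Volume bounds for covers of balls. -/

section Covering

variable {E : Type*} [NormedAddCommGroup E] [NormedSpace ℝ E] [FiniteDimensional ℝ E]

/-- The volume bound for the size of an `ε`-separated subset of a ball. -/
theorem card_le_of_separated_closedBall {ρ ε : ℝ} (hρ : 0 ≤ ρ) (hε : 0 < ε) (s : Finset E)
    (hs : ∀ c ∈ s, ‖c‖ ≤ ρ) (h : ∀ c ∈ s, ∀ d ∈ s, c ≠ d → ε ≤ ‖c - d‖) :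
    (s.card : ℝ) ≤ ((ρ + ε / 2) / (ε / 2)) ^ Module.finrank ℝ E := by
  borelize E
  let μ : Measure E := Measure.addHaar
  have hδ : 0 < ε / 2 := half_pos hε
  have hr : 0 < ρ + ε / 2 := by positivity
  have hdisj : Set.Pairwise (s : Set E)
      (Function.onFun Disjoint fun c => Metric.ball c (ε / 2)) := by
    intro c hc d hd hcd
    apply Metric.ball_disjoint_ball
    rw [dist_eq_norm, add_halves]
    exact h c hc d hd hcd
  have hsub : (⋃ c ∈ s, Metric.ball c (ε / 2)) ⊆ Metric.ball (0 : E) (ρ + ε / 2) := by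
    refine Set.iUnion₂_subset fun x hx => Metric.ball_subset_ball' ?_
    rw [dist_zero_right]
    linarith [hs x hx]
  have hI : (s.card : ENNReal) * ENNReal.ofReal ((ε / 2) ^ Module.finrank ℝ E)
      * μ (Metric.ball 0 1) ≤
      ENNReal.ofReal ((ρ + ε / 2) ^ Module.finrank ℝ E) * μ (Metric.ball 0 1) :=
    calc _ = μ (⋃ c ∈ s, Metric.ball c (ε / 2)) := by
          rw [measure_biUnion_finset hdisj fun c _ => measurableSet_ball]
          simp only [μ.addHaar_ball_of_pos _ hδ, Finset.sum_const, nsmul_eq_mul, mul_assoc]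
      _ ≤ μ (Metric.ball 0 (ρ + ε / 2)) := measure_mono hsub
      _ = _ := μ.addHaar_ball_of_pos _ hr
  have hJ := (ENNReal.mul_le_mul_iff_left (Metric.measure_ball_pos μ _ zero_lt_one).ne'
    measure_ball_lt_top.ne).1 hI
  have hK := ENNReal.toReal_le_of_le_ofReal (pow_nonneg hr.le _) hJ
  rw [ENNReal.toReal_mul, ENNReal.toReal_ofReal (by positivity), ENNReal.toReal_natCast] at hK
  rw [div_pow, le_div_iff₀ (by positivity)]
  exact hK

/-- The volume lower bound for the size of a cover of a ball. -/
theorem pow_finrank_le_of_cover {ι : Type*} [Fintype ι] {ρ ε : ℝ} (hρ : 0 ≤ ρ) (hε : 0 < ε)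
    (c : ι → E) (h : ∀ x : E, ‖x‖ ≤ ρ → ∃ j, ‖x - c j‖ ≤ ε) :
    (ρ / ε) ^ Module.finrank ℝ E ≤ (Fintype.card ι : ℝ) := by
  borelize E
  let μ : Measure E := Measure.addHaar
  have hI : ENNReal.ofReal (ρ ^ Module.finrank ℝ E) * μ (Metric.ball 0 1) ≤
      (Fintype.card ι : ENNReal) * ENNReal.ofReal (ε ^ Module.finrank ℝ E)
        * μ (Metric.ball 0 1) :=
    calc _ = μ (Metric.closedBall 0 ρ) := (μ.addHaar_closedBall _ hρ).symm
      _ ≤ μ (⋃ j, Metric.closedBall (c j) ε) := by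
          refine measure_mono fun x hx => ?_
          obtain ⟨j, hj⟩ := h x (by simpa using hx)
          exact Set.mem_iUnion.2 ⟨j, by simpa [dist_eq_norm] using hj⟩
      _ ≤ ∑ j, μ (Metric.closedBall (c j) ε) := measure_iUnion_fintype_le _ _
      _ = _ := by
          simp only [μ.addHaar_closedBall _ hε.le, Finset.sum_const, nsmul_eq_mul, mul_assoc,
            Finset.card_univ]
  have hJ := (ENNReal.mul_le_mul_iff_left (Metric.measure_ball_pos μ _ zero_lt_one).ne'
    measure_ball_lt_top.ne).1 hI
  have hK := ENNReal.toReal_mono (by finiteness) hJ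
  rw [ENNReal.toReal_mul, ENNReal.toReal_ofReal (by positivity),
    ENNReal.toReal_ofReal (by positivity), ENNReal.toReal_natCast] at hK
  rw [div_pow, div_le_iff₀ (by positivity)]
  exact hK

/-- A ball has a cover by at most `(1 + 2 ρ / ε) ^ dim` balls of radius `ε`. -/
theorem exists_cover_closedBall {ρ ε : ℝ} (hρ : 0 ≤ ρ) (hε : 0 < ε) :
    ∃ s : Finset E, (s.card : ℝ) ≤ ((ρ + ε / 2) / (ε / 2)) ^ Module.finrank ℝ E ∧
      ∀ x : E, ‖x‖ ≤ ρ → ∃ c ∈ s, ‖x - c‖ ≤ ε := by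
  classical
  let P : Set ℕ := {n | ∃ s : Finset E, s.card = n ∧ (∀ c ∈ s, ‖c‖ ≤ ρ) ∧
    ∀ c ∈ s, ∀ d ∈ s, c ≠ d → ε ≤ ‖c - d‖}
  have hP : P.Nonempty := ⟨0, ∅, by simp⟩
  have hb : BddAbove P := by
    refine ⟨⌊((ρ + ε / 2) / (ε / 2)) ^ Module.finrank ℝ E⌋₊, ?_⟩
    rintro _ ⟨s, rfl, h1, h2⟩
    exact Nat.le_floor (card_le_of_separated_closedBall hρ hε s h1 h2)
  -- A separated set of maximal cardinality is a cover, because an uncovered point could be added to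
  -- it.
  obtain ⟨s, hs, h1, h2⟩ := Nat.sSup_mem hP hb
  refine ⟨s, card_le_of_separated_closedBall hρ hε s h1 h2, fun x hx => ?_⟩
  by_contra! hc
  have hxs : x ∉ s := fun h => by
    have := hc x h
    rw [sub_self, norm_zero] at this
    linarith
  have : (insert x s).card ∈ P := by
    refine ⟨insert x s, rfl, ?_, ?_⟩
    · intro c hcs
      rcases Finset.mem_insert.1 hcs with rfl | h
      · exact hx
      · exact h1 c h
    · intro c hcs d hds hcd
      rcases Finset.mem_insert.1 hcs with rfl | h <;> rcases Finset.mem_insert.1 hds with rfl | h'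
      · exact absurd rfl hcd
      · exact (hc d h').le
      · rw [norm_sub_rev]
        exact (hc c h).le
      · exact h2 c h d h' hcd
  have := le_csSup hb this
  rw [Finset.card_insert_of_notMem hxs] at this
  omega

end Covering

/-- The parameter ball has a cover of the size given by the volume bounds. -/
theorem exists_isParamCover {K d : ℕ} [NeZero K] [NeZero d] {ρ ε : ℝ} (hρ : 0 ≤ ρ)
    (hε : 0 < ε) :
    ∃ (N : ℕ) (β : Fin N → Fin K → EuclideanSpace ℝ (Fin d)), IsParamCover ρ ε β ∧
      (ρ / ε) ^ (K * d) ≤ (N : ℝ) ∧ (N : ℝ) ≤ (max 1 (3 * (ρ / ε))) ^ (K * d) := by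
  have hfin : Module.finrank ℝ (Fin K → EuclideanSpace ℝ (Fin d)) = K * d := by
    simp [Module.finrank_pi_fintype]
  have lower : ∀ (N : ℕ) (β : Fin N → Fin K → EuclideanSpace ℝ (Fin d)), IsParamCover ρ ε β →
      (ρ / ε) ^ (K * d) ≤ (N : ℝ) := by
    intro N β hβ
    have := pow_finrank_le_of_cover hρ hε β fun x hx => by
      obtain ⟨j, hj⟩ := hβ x fun a => (norm_le_pi_norm x a).trans hx
      exact ⟨j, (pi_norm_le_iff_of_nonneg hε.le).2 hj⟩
    rwa [hfin, Fintype.card_fin] at this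
  -- For `ρ ≤ ε` one ball suffices, which accounts for the `max 1`; otherwise `1 + 2 * ρ / ε ≤ 3 * ρ
  -- / ε`.
  rcases le_or_gt ρ ε with h | h
  · have hc : IsParamCover ρ ε
        (fun (_ : Fin 1) (_ : Fin K) => (0 : EuclideanSpace ℝ (Fin d))) := fun b hb =>
      ⟨0, fun a => by rw [sub_zero]; exact (hb a).trans h⟩
    exact ⟨1, _, hc, lower _ _ hc, by
      rw [Nat.cast_one]
      exact one_le_pow₀ (le_max_left _ _)⟩
  · obtain ⟨s, hcard, hs⟩ := exists_cover_closedBall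
      (E := Fin K → EuclideanSpace ℝ (Fin d)) hρ hε
    have hc : IsParamCover ρ ε (fun j : Fin s.card => (s.equivFin.symm j).1) := by
      intro b hb
      obtain ⟨c, hcs, hcb⟩ := hs b ((pi_norm_le_iff_of_nonneg hρ).2 hb)
      refine ⟨s.equivFin ⟨c, hcs⟩, fun a => ?_⟩
      simp only [Equiv.symm_apply_apply]
      exact (norm_le_pi_norm (b - c) a).trans hcb
    refine ⟨s.card, _, hc, lower _ _ hc, hcard.trans ?_⟩
    rw [hfin]
    refine pow_le_pow_left₀ (by positivity) (le_max_of_le_right ?_) _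
    have h1 : 3 * (ρ / ε) * (ε / 2) = 3 * ρ / 2 := by field_simp
    rw [div_le_iff₀ (by positivity), h1]
    linarith

/-! ### Majority arms and truncated mixtures. -/

section Mixture

variable {K : ℕ}

theorem mem_majorityArms {v : Fin K → ℝ} {i : Fin K} : i ∈ majorityArms v ↔
    ∑ j ∈ Finset.univ.filter (fun j => v i < v j ∨ (v i = v j ∧ j < i)), v j < 1 / 2 := by
  rw [majorityArms, Finset.mem_filter]
  simp

/-- The majority arms have at least half of the mass. -/
theorem half_le_sum_majorityArms {v : Fin K → ℝ} (hv : ∀ i, 0 ≤ v i) (hv1 : ∑ i, v i = 1) :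
    1 / 2 ≤ ∑ i ∈ majorityArms v, v i := by
  by_contra! h
  have hne : (Finset.univ.filter fun j => j ∉ majorityArms v).Nonempty := by
    by_contra! he
    have : majorityArms v = Finset.univ := by
      ext j
      have := Finset.filter_eq_empty_iff.1 he (Finset.mem_univ j)
      simpa using this
    rw [this, hv1] at h
    norm_num at h
  -- In the lexicographic order the maximum is the first minority arm of the list. All arms before
  -- it are majority arms, so a majority of mass below `1 / 2` would have to contain it.
  obtain ⟨i, hi, hmax⟩ := Finset.exists_max_image _
    (fun j => (toLex (v j, OrderDual.toDual j) : ℝ ×ₗ (Fin K)ᵒᵈ)) hne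
  rw [Finset.mem_filter] at hi
  refine hi.2 (mem_majorityArms.2 (lt_of_le_of_lt ?_ h))
  refine Finset.sum_le_sum_of_subset_of_nonneg (fun j hj => ?_) fun j _ _ => hv j
  by_contra hjM
  have h1 := hmax j (by simpa using hjM)
  rw [Prod.Lex.toLex_le_toLex] at h1
  rw [Finset.mem_filter] at hj
  rcases hj.2 with h2 | ⟨h2, h3⟩
  · rcases h1 with h1 | ⟨h1, -⟩
    · exact lt_asymm h1 h2
    · exact h2.ne' h1
  · rcases h1 with h1 | ⟨-, h1⟩
    · exact h1.ne h2.symm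
    · exact absurd h3 (not_lt.2 (OrderDual.toDual_le_toDual.1 h1))

/-- The arms not listed before `i` carry more than half of the mass; there are at most `K` of them,
each of mass at most `v i`. -/
theorem le_of_mem_majorityArms {v : Fin K → ℝ} (hv : ∀ i, 0 ≤ v i) (hv1 : ∑ i, v i = 1)
    {i : Fin K} (hi : i ∈ majorityArms v) : 1 / (2 * K) ≤ v i := by
  have hK : (0 : ℝ) < K := by exact_mod_cast i.pos
  have h1 := mem_majorityArms.1 hi
  have h2 := Finset.sum_filter_add_sum_filter_not Finset.univ
    (fun j => v i < v j ∨ (v i = v j ∧ j < i)) v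
  have h3 : ∑ j ∈ Finset.univ.filter (fun j => ¬ (v i < v j ∨ (v i = v j ∧ j < i))), v j ≤
      K * v i := by
    calc _ ≤ ∑ j ∈ Finset.univ.filter (fun j => ¬ (v i < v j ∨ (v i = v j ∧ j < i))), v i := by
          refine Finset.sum_le_sum fun j hj => ?_
          rw [Finset.mem_filter] at hj
          by_contra! h
          exact hj.2 (Or.inl h)
      _ ≤ ∑ j : Fin K, v i :=
          Finset.sum_le_sum_of_subset_of_nonneg (Finset.filter_subset _ _) fun _ _ _ => hv i
      _ = K * v i := by simp
  rw [div_le_iff₀ (by positivity)]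
  linarith

/-- The properties of the mixture `q` and its majority arms `M` on which the analysis rests. -/
structure IsMajorityMix (M : Finset (Fin K)) (q : Fin K → ℝ) : Prop where
  nonneg : ∀ i, 0 ≤ q i
  sum_eq_one : ∑ i, q i = 1
  le_of_mem : ∀ i ∈ M, 1 / (2 * K) ≤ q i
  half_le : 1 / 2 ≤ ∑ i ∈ M, q i

/-- Auxiliary experts can only lower the minority coordinates relative to the base mixture. The
majority coordinates are thus those of the base mixture times a factor at least `1`, and inherit its
lower bounds. -/
theorem isMajorityMix_mygaMix {N : ℕ} (S : Finset ℝ) (w : MygaWeights N)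
    (ξ : Fin N → Fin K → ℝ) (hw : 0 < ∑ e, w.base e) (hbase : ∀ e, 0 ≤ w.base e)
    (haux : ∀ s ∈ S, 0 ≤ w.aux s) (hξ : ∀ e i, 0 ≤ ξ e i) (hξ1 : ∀ e, ∑ i, ξ e i = 1) :
    IsMajorityMix (majorityArms (baseMix w ξ)) (mygaMix S w ξ) := by
  have hc : ∀ i, 0 ≤ ∑ e, w.base e * ξ e i := fun i =>
    Finset.sum_nonneg fun e _ => mul_nonneg (hbase e) (hξ e i)
  have hv : ∀ i, baseMix w ξ i * ∑ e, w.base e = ∑ e, w.base e * ξ e i := fun i =>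
    div_mul_cancel₀ _ hw.ne'
  have hv0 : ∀ i, 0 ≤ baseMix w ξ i := fun i => div_nonneg (hc i) hw.le
  have hv1 : ∑ i, baseMix w ξ i = 1 := by
    have : (∑ i, baseMix w ξ i) * ∑ e, w.base e = 1 * ∑ e, w.base e := by
      rw [Finset.sum_mul, Finset.sum_congr rfl fun i _ => hv i, Finset.sum_comm, one_mul]
      exact Finset.sum_congr rfl fun e _ => by rw [← Finset.mul_sum, hξ1, mul_one]
    exact mul_right_cancel₀ hw.ne' this
  have hV := half_le_sum_majorityArms hv0 hv1
  have hvM := fun i => le_of_mem_majorityArms hv0 hv1 (i := i)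
  set v := baseMix w ξ with hvdef
  set M := majorityArms v with hM
  have hm0 : ∀ j, 0 ≤ minoritySol S w ξ j := fun j =>
    (minoritySol_spec S w ξ j hw haux (hc j)).1.1
  have hle : ∀ j, minoritySol S w ξ j ≤ v j := by
    intro j
    have h := (minoritySol_spec S w ξ j hw haux (hc j)).1.2
    have h1 : ∑ s ∈ S.filter (fun s => s < minoritySol S w ξ j),
        w.aux s * minoritySol S w ξ j ≤ (∑ s ∈ S, w.aux s) * minoritySol S w ξ j := by
      rw [Finset.sum_mul]
      exact Finset.sum_le_sum_of_subset_of_nonneg (Finset.filter_subset _ _) fun s hs _ =>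
        mul_nonneg (haux s hs) (hm0 j)
    rw [← hv j] at h
    have : minoritySol S w ξ j * ∑ e, w.base e ≤ v j * ∑ e, w.base e := by linarith
    exact le_of_mul_le_mul_right this hw
  set Qn := ∑ j ∈ Finset.univ.filter (fun j => j ∉ M), minoritySol S w ξ j with hQn
  set V := ∑ j ∈ M, v j with hVdef
  have hVpos : 0 < V := by linarith
  have hVn : ∑ j ∈ Finset.univ.filter (fun j => j ∉ M), v j = 1 - V := by
    have h := Finset.sum_filter_add_sum_filter_not Finset.univ (fun j => j ∈ M) v
    rw [hv1, Finset.filter_mem_eq_inter, Finset.univ_inter] at h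
    linarith
  have hQV : V ≤ 1 - Qn := by
    have : Qn ≤ 1 - V := by
      rw [← hVn]
      exact Finset.sum_le_sum fun j _ => hle j
    linarith
  have hqm : ∀ j ∈ M, mygaMix S w ξ j = v j * ((1 - Qn) / V) := fun j hj => by
    simp only [mygaMix]
    exact if_pos hj
  have hqn : ∀ j, j ∉ M → mygaMix S w ξ j = minoritySol S w ξ j := fun j hj => by
    simp only [mygaMix]
    exact if_neg hj
  have hfac : 1 ≤ (1 - Qn) / V := (one_le_div hVpos).2 hQV
  have hQm : ∑ j ∈ M, mygaMix S w ξ j = 1 - Qn := by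
    rw [Finset.sum_congr rfl hqm, ← Finset.sum_mul, ← hVdef, mul_div_cancel₀ _ hVpos.ne']
  have hge : ∀ j ∈ M, v j ≤ mygaMix S w ξ j := fun j hj => by
    rw [hqm j hj]
    exact le_mul_of_one_le_right (hv0 j) hfac
  refine ⟨fun i => ?_, ?_, fun i hi => (hvM i hi).trans (hge i hi), ?_⟩
  · by_cases hi : i ∈ M
    · exact (hv0 i).trans (hge i hi)
    · rw [hqn i hi]
      exact hm0 i
  · have h := Finset.sum_filter_add_sum_filter_not Finset.univ (fun j => j ∈ M) (mygaMix S w ξ)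
    rw [Finset.filter_mem_eq_inter, Finset.univ_inter, hQm,
      Finset.sum_congr rfl fun j hj => hqn j (Finset.mem_filter.1 hj).2, ← hQn] at h
    linarith
  · rw [hQm]
    exact hV.trans hQV

/-- The mass that the truncation at level `s` moves. -/
noncomputable def smallMass (M : Finset (Fin K)) (q : Fin K → ℝ) (s : ℝ) : ℝ :=
  ∑ j ∈ Finset.univ.filter (fun j => j ∉ M ∧ q j ≤ s), q j

theorem truncArms_of_mem {M : Finset (Fin K)} {q : Fin K → ℝ} {s : ℝ} {i : Fin K}
    (hi : i ∈ M) : truncArms M s q i = q i * (1 + smallMass M q s / ∑ j ∈ M, q j) := by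
  simp [truncArms, hi, smallMass]

theorem truncArms_of_notMem {M : Finset (Fin K)} {q : Fin K → ℝ} {s : ℝ} {i : Fin K}
    (hi : i ∉ M) : truncArms M s q i = if q i ≤ s then 0 else q i := by
  simp [truncArms, hi]

theorem smallMass_le_mul {M : Finset (Fin K)} {q : Fin K → ℝ} {s : ℝ}
    (hs : 0 ≤ s) : smallMass M q s ≤ K * s := by
  calc smallMass M q s ≤ ∑ j ∈ Finset.univ.filter (fun j => j ∉ M ∧ q j ≤ s), s :=
        Finset.sum_le_sum fun j hj => (Finset.mem_filter.1 hj).2.2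
    _ ≤ ∑ j : Fin K, s :=
        Finset.sum_le_sum_of_subset_of_nonneg (Finset.filter_subset _ _) fun _ _ _ => hs
    _ = K * s := by simp

namespace IsMajorityMix

variable {M : Finset (Fin K)} {q : Fin K → ℝ} (h : IsMajorityMix M q)

include h

theorem sum_compl : ∑ i ∈ Finset.univ.filter (fun j => j ∉ M), q i = 1 - ∑ i ∈ M, q i := by
  have h1 := Finset.sum_filter_add_sum_filter_not Finset.univ (fun j => j ∈ M) q
  rw [h.sum_eq_one, Finset.filter_mem_eq_inter, Finset.univ_inter] at h1
  linarith

theorem le_half {i : Fin K} (hi : i ∉ M) : q i ≤ 1 / 2 := by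
  have h1 := Finset.single_le_sum (f := q) (s := Finset.univ.filter (fun j => j ∉ M))
    (fun j _ => h.nonneg j) (by simpa using hi : i ∈ _)
  rw [h.sum_compl] at h1
  linarith [h.half_le]

theorem smallMass_nonneg (s : ℝ) : 0 ≤ smallMass M q s :=
  Finset.sum_nonneg fun j _ => h.nonneg j

theorem smallMass_le (s : ℝ) : smallMass M q s ≤ 1 - ∑ i ∈ M, q i := by
  rw [← h.sum_compl]
  refine Finset.sum_le_sum_of_subset_of_nonneg (fun j hj => ?_) fun j _ _ => h.nonneg j
  simp only [Finset.mem_filter] at hj ⊢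
  exact ⟨hj.1, hj.2.1⟩

theorem sum_pos : 0 < ∑ j ∈ M, q j := by linarith [h.half_le]

theorem le_truncArms (s : ℝ) {i : Fin K} (hi : i ∈ M) : q i ≤ truncArms M s q i := by
  rw [truncArms_of_mem hi]
  refine le_mul_of_one_le_right (h.nonneg i) ?_
  linarith [div_nonneg (h.smallMass_nonneg s) h.sum_pos.le]

/-- At most `K * s` is moved, proportionally, onto arms of total mass at least `1 / 2`. This is the
price of playing the truncation instead of `q`. -/
theorem truncArms_le {s : ℝ} (hs : 0 ≤ s) (i : Fin K) :
    truncArms M s q i ≤ (1 + 2 * K * s) * q i := by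
  by_cases hi : i ∈ M
  · rw [truncArms_of_mem hi, mul_comm]
    refine mul_le_mul_of_nonneg_right ?_ (h.nonneg i)
    rw [add_le_add_iff_left, div_le_iff₀ h.sum_pos]
    nlinarith [smallMass_le_mul (M := M) (q := q) hs, h.half_le,
      mul_nonneg (Nat.cast_nonneg (α := ℝ) K) hs]
  · rw [truncArms_of_notMem hi]
    have : 0 ≤ 2 * (K : ℝ) * s * q i := mul_nonneg (by positivity) (h.nonneg i)
    split_ifs
    · linarith [h.nonneg i]
    · linarith

theorem truncArms_nonneg (s : ℝ) (i : Fin K) : 0 ≤ truncArms M s q i := by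
  by_cases hi : i ∈ M
  · exact (h.nonneg i).trans (h.le_truncArms s hi)
  · rw [truncArms_of_notMem hi]
    split_ifs
    exacts [le_rfl, h.nonneg i]

theorem le_one (i : Fin K) : q i ≤ 1 := by
  rw [← h.sum_eq_one]
  exact Finset.single_le_sum (fun j _ => h.nonneg j) (Finset.mem_univ i)

/-- The moved mass is at most what the majority arms lack, so the rescaling factor is at most the
inverse of their mass. It makes the auxiliary advice admissible in the exponential weights
inequality. -/
theorem truncArms_le_one (s : ℝ) (i : Fin K) : truncArms M s q i ≤ 1 := by
  by_cases hi : i ∈ M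
  · have h1 := Finset.single_le_sum (f := q) (fun j _ => h.nonneg j) hi
    have h3 : 1 + smallMass M q s / ∑ j ∈ M, q j ≤ 1 / ∑ j ∈ M, q j := by
      rw [le_div_iff₀ h.sum_pos, add_mul, div_mul_cancel₀ _ h.sum_pos.ne']
      linarith [h.smallMass_le s]
    rw [truncArms_of_mem hi]
    calc _ ≤ q i * (1 / ∑ j ∈ M, q j) := mul_le_mul_of_nonneg_left h3 (h.nonneg i)
      _ = q i / ∑ j ∈ M, q j := by ring
      _ ≤ 1 := (div_le_one h.sum_pos).2 h1
  · rw [truncArms_of_notMem hi]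
    split_ifs
    exacts [zero_le_one, h.le_one i]

/-- The arms in the support of a truncation have probability at least the truncation level. -/
theorem of_truncArms_pos {s : ℝ} {i : Fin K} (hp : 0 < truncArms M s q i) :
    q i ≤ truncArms M s q i ∧ (i ∉ M → s < q i) := by
  by_cases hi : i ∈ M
  · exact ⟨h.le_truncArms s hi, fun h' => absurd hi h'⟩
  · rw [truncArms_of_notMem hi] at hp ⊢
    split_ifs at hp ⊢ with h1
    · exact absurd hp (lt_irrefl _)
    · exact ⟨le_rfl, fun _ => not_le.1 h1⟩

/-- A lower bound on the support that does not depend on the history: it keeps the importance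
weights bounded, hence integrable. -/
theorem min_le_of_truncArms_pos {s : ℝ} {i : Fin K} (hp : 0 < truncArms M s q i) :
    min s (1 / (2 * K)) ≤ truncArms M s q i := by
  obtain ⟨h1, h2⟩ := h.of_truncArms_pos hp
  by_cases hi : i ∈ M
  · exact (min_le_right _ _).trans ((h.le_of_mem i hi).trans h1)
  · exact (min_le_left _ _).trans ((h2 hi).le.trans h1)

end IsMajorityMix

end Mixture

/-! ### Averaging over the truncation thresholds. -/

section Grid

theorem mem_mygaThresholds {T : ℕ} {γ s : ℝ} :
    s ∈ mygaThresholds T γ ↔ ∃ m ∈ Finset.Icc 1 T, (m : ℝ) / (2 * T) = s ∧ γ < s := by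
  simp only [mygaThresholds, Finset.mem_filter, Finset.mem_image]
  constructor
  · rintro ⟨⟨m, hm, rfl⟩, h⟩
    exact ⟨m, hm, rfl, h⟩
  · rintro ⟨m, hm, rfl, h⟩
    exact ⟨⟨m, hm, rfl⟩, h⟩

theorem card_mygaThresholds_le (T : ℕ) (γ : ℝ) : (mygaThresholds T γ).card ≤ T := by
  refine (Finset.card_filter_le _ _).trans (Finset.card_image_le.trans ?_)
  simp

theorem sum_Icc_telescope (g : ℕ → ℝ) {m T : ℕ} (h : m ≤ T) :
    ∑ k ∈ Finset.Icc m T, (g k - g (k + 1)) = g m - g (T + 1) := by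
  induction T, h using Nat.le_induction with
  | base => simp
  | succ n hn ih => rw [Finset.sum_Icc_succ_top (by omega), ih]; ring

/-- Coefficients on the thresholds whose tail sums are comparable with `1 / x`. -/
theorem exists_threshold_coeff {T : ℕ} {γ : ℝ} (hT : 0 < T) (hγ : 0 < γ)
    (hγT : 1 / (2 * T) ≤ γ) :
    ∃ c : ℝ → ℝ, (∀ s ∈ mygaThresholds T γ, 0 ≤ c s) ∧
      (∀ x, 0 < x → ∑ s ∈ (mygaThresholds T γ).filter (fun s => x ≤ s), c s ≤ 1 / x) ∧
      (∀ x, γ < x → x ≤ 1 / 2 →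
        1 / (2 * x) ≤ ∑ s ∈ (mygaThresholds T γ).filter (fun s => x ≤ s), c s) := by
  have hT' : (0 : ℝ) < T := by exact_mod_cast hT
  -- The reciprocal of the threshold `m / (2 * T)`, cut to `0` beyond `T`. Its decrements are the
  -- coefficients, so the tail starting at a threshold telescopes to the reciprocal of that
  -- threshold.
  let g : ℕ → ℝ := fun m => if m ≤ T then 2 * T / m else 0
  have hg : ∀ m ∈ Finset.Icc 1 T, 0 ≤ g m - g (m + 1) := by
    intro m hm
    rw [Finset.mem_Icc] at hm
    have hm' : (0 : ℝ) < m := by exact_mod_cast hm.1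
    simp only [g, if_pos hm.2]
    split_ifs
    · rw [sub_nonneg]
      push_cast
      gcongr
      linarith
    · rw [sub_zero]
      positivity
  have htail : ∀ m ∈ Finset.Icc 1 T, ∑ k ∈ Finset.Icc m T, (g k - g (k + 1)) = 2 * T / m := by
    intro m hm
    rw [Finset.mem_Icc] at hm
    rw [sum_Icc_telescope g hm.2]
    simp [g, hm.2]
  have hinj : Function.Injective fun m : ℕ => (m : ℝ) / (2 * T) := by
    intro m n hmn
    have h2 : (m : ℝ) = n := by
      have : (m : ℝ) / (2 * T) = n / (2 * T) := hmn
      field_simp at this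
      exact this
    exact_mod_cast h2
  obtain ⟨c, hc⟩ : ∃ c : ℝ → ℝ, ∀ m : ℕ, c ((m : ℝ) / (2 * T)) = g m - g (m + 1) :=
    ⟨Function.extend (fun m : ℕ => (m : ℝ) / (2 * T)) (fun m => g m - g (m + 1)) 0,
      fun m => hinj.extend_apply _ _ m⟩
  have hsum : ∀ x, ∑ s ∈ (mygaThresholds T γ).filter (fun s => x ≤ s), c s =
      ∑ m ∈ (Finset.Icc 1 T).filter
        (fun m : ℕ => γ < (m : ℝ) / (2 * T) ∧ x ≤ (m : ℝ) / (2 * T)), (g m - g (m + 1)) := by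
    intro x
    rw [mygaThresholds, Finset.filter_filter, Finset.filter_image,
      Finset.sum_image fun a _ b _ hab => hinj hab]
    exact Finset.sum_congr rfl fun m _ => hc m
  have hceil : ∀ x (m : ℕ), x ≤ (m : ℝ) / (2 * T) ↔ ⌈2 * T * x⌉₊ ≤ m := by
    intro x m
    rw [Nat.ceil_le, le_div_iff₀ (by positivity), mul_comm]
  refine ⟨c, ?_, ?_, ?_⟩
  · intro s hs
    obtain ⟨m, hm, rfl, -⟩ := mem_mygaThresholds.1 hs
    rw [hc]
    exact hg m hm
  · intro x hx
    rw [hsum]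
    have hpos : 1 ≤ ⌈2 * T * x⌉₊ := Nat.ceil_pos.2 (by positivity)
    by_cases hle : ⌈2 * T * x⌉₊ ≤ T
    · calc _ ≤ ∑ k ∈ Finset.Icc ⌈2 * T * x⌉₊ T, (g k - g (k + 1)) := by
            refine Finset.sum_le_sum_of_subset_of_nonneg (fun m hm => ?_) fun m hm _ => hg m ?_
            · rw [Finset.mem_filter, hceil x] at hm
              exact Finset.mem_Icc.2 ⟨hm.2.2, (Finset.mem_Icc.1 hm.1).2⟩
            · rw [Finset.mem_Icc] at hm ⊢
              omega
        _ = 2 * T / ⌈2 * T * x⌉₊ := htail _ (Finset.mem_Icc.2 ⟨hpos, hle⟩)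
        _ ≤ 1 / x := by
            have := Nat.le_ceil (2 * T * x)
            rw [div_le_div_iff₀ (by exact_mod_cast hpos) hx]
            linarith
    · rw [Finset.sum_eq_zero]
      · positivity
      · intro m hm
        rw [Finset.mem_filter, hceil x, Finset.mem_Icc] at hm
        omega
  · intro x hx hx2
    have hx0 : 0 < x := hγ.trans hx
    rw [hsum]
    have hpos : 1 ≤ ⌈2 * T * x⌉₊ := Nat.ceil_pos.2 (by positivity)
    have hle : ⌈2 * T * x⌉₊ ≤ T := Nat.ceil_le.2 (by nlinarith)
    have hfil : (Finset.Icc 1 T).filter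
        (fun m : ℕ => γ < (m : ℝ) / (2 * T) ∧ x ≤ (m : ℝ) / (2 * T)) =
        Finset.Icc ⌈2 * T * x⌉₊ T := by
      ext m
      rw [Finset.mem_filter, Finset.mem_Icc, Finset.mem_Icc]
      constructor
      · rintro ⟨h1, -, h2⟩
        exact ⟨(hceil x m).1 h2, h1.2⟩
      · rintro ⟨h1, h2⟩
        have h3 := (hceil x m).2 h1
        exact ⟨⟨hpos.trans h1, h2⟩, hx.trans_le h3, h3⟩
    -- Rounding `2 * T * x` up costs a factor at most `2`, because `x > γ ≥ 1 / (2 * T)` makes it at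
    -- least `1`.
    rw [hfil, htail _ (Finset.mem_Icc.2 ⟨hpos, hle⟩)]
    have h1 := (Nat.ceil_lt_add_one (a := 2 * T * x) (by positivity)).le
    have h2 : 1 ≤ 2 * T * x := by
      rw [div_le_iff₀ (by positivity)] at hγT
      nlinarith
    rw [div_le_div_iff₀ (by positivity) (by exact_mod_cast hpos)]
    nlinarith

end Grid

/-! ### Exponential weights with the self-consistent mixture. -/

section Hedge

/-- The product of `1 + x + x ^ 2 / 2` and `1 - x + x ^ 2 / 2` is `1 + x ^ 4 / 4`, and the first
factor is at most `exp x`. -/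
theorem exp_neg_le_quadratic {x : ℝ} (hx : 0 ≤ x) : Real.exp (-x) ≤ 1 - x + x ^ 2 / 2 := by
  have h := Real.quadratic_le_exp_of_nonneg hx
  have hpos : 0 < 1 + x + x ^ 2 / 2 := by positivity
  rw [Real.exp_neg]
  calc (Real.exp x)⁻¹ ≤ (1 + x + x ^ 2 / 2)⁻¹ := inv_anti₀ hpos h
    _ ≤ 1 - x + x ^ 2 / 2 := by
      rw [inv_le_iff_one_le_mul₀ hpos]
      nlinarith [sq_nonneg (x ^ 2)]

/-- For `x i` in the unit interval `x i ^ 2 ≤ x i`, so the second-order term is also linear in the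
advice and only the average `∑ w i * x i` appears. -/
theorem sum_mul_exp_le {ι : Type*} (s : Finset ι) (w x : ι → ℝ) {η z : ℝ}
    (hw : ∀ i ∈ s, 0 ≤ w i) (hx : ∀ i ∈ s, x i ∈ Set.Icc (0 : ℝ) 1) (hη : 0 ≤ η)
    (hz : 0 ≤ z) :
    ∑ i ∈ s, w i * Real.exp (-η * (x i * z)) ≤
      ∑ i ∈ s, w i - (η * z - η ^ 2 * z ^ 2 / 2) * ∑ i ∈ s, w i * x i := by
  rw [Finset.mul_sum, ← Finset.sum_sub_distrib]
  refine Finset.sum_le_sum fun i hi => ?_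
  obtain ⟨h0, h1⟩ := hx i hi
  have h2 := exp_neg_le_quadratic (x := η * (x i * z)) (by positivity)
  have h3 : x i ^ 2 * (η ^ 2 * z ^ 2) ≤ x i * (η ^ 2 * z ^ 2) :=
    mul_le_mul_of_nonneg_right (by nlinarith) (by positivity)
  calc w i * Real.exp (-η * (x i * z))
      ≤ w i * (1 - η * (x i * z) + x i * (η ^ 2 * z ^ 2) / 2) := by
        refine mul_le_mul_of_nonneg_left ?_ (hw i hi)
        rw [neg_mul]
        refine h2.trans ?_
        nlinarith
    _ = _ := by ring

variable {N K : ℕ} (T : ℕ) (η γ : ℝ) (ξ : ℕ → Fin N → Fin K → ℝ) (A : ℕ → Fin K) (y : ℕ → ℝ)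

/-- The mixture of MYGA in round `t`. -/
noncomputable def mygaMixAt (t : ℕ) : Fin K → ℝ :=
  mygaMix (mygaThresholds T γ) (mygaWeights T η γ ξ A y t) (ξ t)

/-- The majority arms of MYGA in round `t`. -/
noncomputable def mygaMajorityAt (t : ℕ) : Finset (Fin K) :=
  majorityArms (baseMix (mygaWeights T η γ ξ A y t) (ξ t))

/-- The importance weighted loss estimate of the played arm in round `t`. -/
noncomputable def mygaEst (t : ℕ) : ℝ := y t / mygaProb T η γ ξ A y t (A t)

theorem mygaProb_eq (t : ℕ) : mygaProb T η γ ξ A y t =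
    truncArms (mygaMajorityAt T η γ ξ A y t) γ (mygaMixAt T η γ ξ A y t) := rfl

theorem mygaWeights_pos (t : ℕ) : (∀ e, 0 < (mygaWeights T η γ ξ A y t).base e) ∧
    ∀ s, 0 < (mygaWeights T η γ ξ A y t).aux s := by
  induction t with
  | zero => exact ⟨fun _ => one_pos, fun _ => one_pos⟩
  | succ t ih =>
    exact ⟨fun e => mul_pos (ih.1 e) (Real.exp_pos _), fun s => mul_pos (ih.2 s) (Real.exp_pos _)⟩

theorem mygaWeights_base (t : ℕ) (e : Fin N) : (mygaWeights T η γ ξ A y t).base e =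
    Real.exp (-η * ∑ s ∈ Finset.range t, ξ s e (A s) * mygaEst T η γ ξ A y s) := by
  induction t with
  | zero => simp [mygaWeights]
  | succ t ih =>
    rw [Finset.sum_range_succ, mul_add, Real.exp_add, ← ih]
    rfl

theorem mygaWeights_aux (t : ℕ) (r : ℝ) : (mygaWeights T η γ ξ A y t).aux r =
    Real.exp (-η * ∑ s ∈ Finset.range t, truncArms (mygaMajorityAt T η γ ξ A y s) r
      (mygaMixAt T η γ ξ A y s) (A s) * mygaEst T η γ ξ A y s) := by
  induction t with
  | zero => simp [mygaWeights]
  | succ t ih =>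
    rw [Finset.sum_range_succ, mul_add, Real.exp_add, ← ih]
    rfl

/-- The total weight of the base and auxiliary experts. -/
noncomputable def mygaTotal (t : ℕ) : ℝ :=
  ∑ e, (mygaWeights T η γ ξ A y t).base e +
    ∑ s ∈ mygaThresholds T γ, (mygaWeights T η γ ξ A y t).aux s

variable {T η γ ξ A y}

theorem isMajorityMix_mygaMixAt [NeZero N] (hξ : ∀ t e i, 0 ≤ ξ t e i)
    (hξ1 : ∀ t e, ∑ i, ξ t e i = 1) (t : ℕ) :
    IsMajorityMix (mygaMajorityAt T η γ ξ A y t) (mygaMixAt T η γ ξ A y t) :=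
  have h := mygaWeights_pos T η γ ξ A y t
  isMajorityMix_mygaMix _ _ _ (Finset.sum_pos (fun e _ => h.1 e) Finset.univ_nonempty)
    (fun e => (h.1 e).le) (fun s _ => (h.2 s).le) (hξ t) (hξ1 t)

theorem mygaEst_nonneg [NeZero N] (hξ : ∀ t e i, 0 ≤ ξ t e i)
    (hξ1 : ∀ t e, ∑ i, ξ t e i = 1) {t : ℕ} (hy : 0 ≤ y t) : 0 ≤ mygaEst T η γ ξ A y t :=
  div_nonneg hy ((isMajorityMix_mygaMixAt hξ hξ1 t).truncArms_nonneg γ (A t))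

/-- By self-consistency the weighted average of all advice for the played arm, auxiliary experts
included, is exactly its coordinate in `q`. The decay of the total weight is therefore measured by
`q`, although the arm is drawn from the truncation. -/
theorem mygaTotal_succ_le [NeZero N] (hη : 0 ≤ η) (hξ : ∀ t e i, 0 ≤ ξ t e i)
    (hξ1 : ∀ t e, ∑ i, ξ t e i = 1) {t : ℕ} (hy : 0 ≤ y t) :
    mygaTotal T η γ ξ A y (t + 1) ≤ mygaTotal T η γ ξ A y t *
      Real.exp (-η * (mygaMixAt T η γ ξ A y t (A t) * mygaEst T η γ ξ A y t) +
        η ^ 2 / 2 * (mygaMixAt T η γ ξ A y t (A t) * mygaEst T η γ ξ A y t ^ 2)) := by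
  have hmix := isMajorityMix_mygaMixAt (T := T) (η := η) (γ := γ) (A := A) (y := y) hξ hξ1 t
  obtain ⟨hb, ha⟩ := mygaWeights_pos T η γ ξ A y t
  have hz := mygaEst_nonneg (T := T) (η := η) (γ := γ) (A := A) hξ hξ1 hy
  have heq : mygaMixAt T η γ ξ A y t (A t) =
      (∑ e, (mygaWeights T η γ ξ A y t).base e * ξ t e (A t) +
        ∑ s ∈ mygaThresholds T γ, (mygaWeights T η γ ξ A y t).aux s *
          truncArms (mygaMajorityAt T η γ ξ A y t) s (mygaMixAt T η γ ξ A y t) (A t)) /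
        (∑ e, (mygaWeights T η γ ξ A y t).base e +
          ∑ s ∈ mygaThresholds T γ, (mygaWeights T η γ ξ A y t).aux s) :=
    mygaMix_eq (mygaThresholds T γ) (mygaWeights T η γ ξ A y t) (ξ t)
      (Finset.sum_pos (fun e _ => hb e) Finset.univ_nonempty)
      (fun e => (hb e).le) (fun s _ => (ha s).le) (hξ t) (hξ1 t) (A t)
  set q := mygaMixAt T η γ ξ A y t with hq
  set M := mygaMajorityAt T η γ ξ A y t with hM
  set z := mygaEst T η γ ξ A y t with hzdef
  set w := mygaWeights T η γ ξ A y t with hw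
  have hW : 0 < ∑ e, w.base e + ∑ s ∈ mygaThresholds T γ, w.aux s :=
    add_pos_of_pos_of_nonneg (Finset.sum_pos (fun e _ => hb e) Finset.univ_nonempty)
      (Finset.sum_nonneg fun s _ => (ha s).le)
  rw [eq_div_iff hW.ne'] at heq
  have h1 := sum_mul_exp_le Finset.univ w.base (fun e => ξ t e (A t)) (fun e _ => (hb e).le)
    (fun e _ => ⟨hξ t e _, by
      rw [← hξ1 t e]
      exact Finset.single_le_sum (fun j _ => hξ t e j) (Finset.mem_univ (A t))⟩) hη hz
  have h2 := sum_mul_exp_le (mygaThresholds T γ) w.aux (fun s => truncArms M s q (A t))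
    (fun s _ => (ha s).le)
    (fun s _ => ⟨hmix.truncArms_nonneg s _, hmix.truncArms_le_one s _⟩) hη hz
  have hstep : mygaTotal T η γ ξ A y (t + 1) =
      ∑ e, w.base e * Real.exp (-η * (ξ t e (A t) * z)) +
      ∑ s ∈ mygaThresholds T γ, w.aux s * Real.exp (-η * (truncArms M s q (A t) * z)) := rfl
  have h3 := Real.add_one_le_exp (-η * (q (A t) * z) + η ^ 2 / 2 * (q (A t) * z ^ 2))
  calc mygaTotal T η γ ξ A y (t + 1) ≤
      (∑ e, w.base e + ∑ s ∈ mygaThresholds T γ, w.aux s) *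
        (-η * (q (A t) * z) + η ^ 2 / 2 * (q (A t) * z ^ 2) + 1) := by
        rw [hstep]
        refine (add_le_add h1 h2).trans (le_of_eq ?_)
        linear_combination (η * z - η ^ 2 * z ^ 2 / 2) * heq
    _ ≤ _ := mul_le_mul_of_nonneg_left h3 hW.le

theorem mygaTotal_le [NeZero N] (hη : 0 ≤ η) (hξ : ∀ t e i, 0 ≤ ξ t e i)
    (hξ1 : ∀ t e, ∑ i, ξ t e i = 1) {n : ℕ} (hy : ∀ t < n, 0 ≤ y t) :
    mygaTotal T η γ ξ A y n ≤ (N + T : ℝ) * Real.exp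
      (∑ t ∈ Finset.range n, (-η * (mygaMixAt T η γ ξ A y t (A t) * mygaEst T η γ ξ A y t) +
        η ^ 2 / 2 * (mygaMixAt T η γ ξ A y t (A t) * mygaEst T η γ ξ A y t ^ 2))) := by
  induction n with
  | zero =>
    have := card_mygaThresholds_le T γ
    simp only [mygaTotal, mygaWeights, Finset.sum_const, Finset.card_univ, Fintype.card_fin,
      nsmul_eq_mul, mul_one, Finset.range_zero, Finset.sum_empty, Real.exp_zero]
    gcongr
  | succ n ih =>
    rw [Finset.sum_range_succ, Real.exp_add, ← mul_assoc]
    exact (mygaTotal_succ_le hη hξ hξ1 (hy n (by omega))).trans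
      (mul_le_mul_of_nonneg_right (ih fun t ht => hy t (by omega)) (Real.exp_pos _).le)

/-- The regret bound of exponential weights, for an advice sequence `x` whose exponential weight
is dominated by the total weight. -/
theorem sum_sub_mul_mygaEst_le [NeZero N] (hη : 0 < η) (hξ : ∀ t e i, 0 ≤ ξ t e i)
    (hξ1 : ∀ t e, ∑ i, ξ t e i = 1) {n : ℕ} (hy : ∀ t < n, y t ∈ Set.Icc (0 : ℝ) 1)
    (hp : ∀ t < n, 0 < mygaProb T η γ ξ A y t (A t)) (x : ℕ → ℝ)
    (hx : Real.exp (-η * ∑ t ∈ Finset.range n, x t * mygaEst T η γ ξ A y t) ≤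
      mygaTotal T η γ ξ A y n) :
    ∑ t ∈ Finset.range n, (mygaMixAt T η γ ξ A y t (A t) - x t) * mygaEst T η γ ξ A y t ≤
      Real.log (N + T) / η + η / 2 * ∑ t ∈ Finset.range n, mygaEst T η γ ξ A y t := by
  have hN : (0 : ℝ) < N + T := by
    have : (0 : ℝ) < N := by exact_mod_cast NeZero.pos N
    positivity
  have h1 := hx.trans (mygaTotal_le hη.le hξ hξ1 fun t ht => (hy t ht).1)
  rw [← Real.exp_log hN, ← Real.exp_add, Real.exp_le_exp, Finset.sum_add_distrib,
    ← Finset.mul_sum, ← Finset.mul_sum] at h1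
  -- On the support truncation does not lower a probability, so `q * z ≤ y ≤ 1` for the played arm,
  -- and one factor `z` of the second-order term disappears.
  have h2 : ∑ t ∈ Finset.range n, mygaMixAt T η γ ξ A y t (A t) * mygaEst T η γ ξ A y t ^ 2 ≤
      ∑ t ∈ Finset.range n, mygaEst T η γ ξ A y t := by
    refine Finset.sum_le_sum fun t ht => ?_
    rw [Finset.mem_range] at ht
    have hmix := isMajorityMix_mygaMixAt (T := T) (η := η) (γ := γ) (A := A) (y := y) hξ hξ1 t
    have hz := mygaEst_nonneg (T := T) (η := η) (γ := γ) (A := A) hξ hξ1 (hy t ht).1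
    have hle := (hmix.of_truncArms_pos (hp t ht)).1
    have h3 : mygaMixAt T η γ ξ A y t (A t) * mygaEst T η γ ξ A y t ≤ 1 := by
      rw [mygaEst, mul_div_assoc', div_le_one (hp t ht)]
      exact (mul_le_of_le_one_right (hmix.nonneg _) (hy t ht).2).trans hle
    calc _ = (mygaMixAt T η γ ξ A y t (A t) * mygaEst T η γ ξ A y t) *
          mygaEst T η γ ξ A y t := by ring
      _ ≤ _ := mul_le_of_le_one_left hz h3
  simp only [sub_mul, Finset.sum_sub_distrib]
  have h4 := mul_le_mul_of_nonneg_left h2 (by positivity : 0 ≤ η ^ 2 / 2)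
  rw [div_add' _ _ _ hη.ne', le_div_iff₀ hη]
  linarith

theorem base_regret_le [NeZero N] (hη : 0 < η) (hξ : ∀ t e i, 0 ≤ ξ t e i)
    (hξ1 : ∀ t e, ∑ i, ξ t e i = 1) {n : ℕ} (hy : ∀ t < n, y t ∈ Set.Icc (0 : ℝ) 1)
    (hp : ∀ t < n, 0 < mygaProb T η γ ξ A y t (A t)) (e : Fin N) :
    ∑ t ∈ Finset.range n, (mygaMixAt T η γ ξ A y t (A t) - ξ t e (A t)) *
      mygaEst T η γ ξ A y t ≤
      Real.log (N + T) / η + η / 2 * ∑ t ∈ Finset.range n, mygaEst T η γ ξ A y t := by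
  refine sum_sub_mul_mygaEst_le hη hξ hξ1 hy hp _ ?_
  obtain ⟨hb, ha⟩ := mygaWeights_pos T η γ ξ A y n
  rw [← mygaWeights_base]
  exact (Finset.single_le_sum (fun e _ => (hb e).le) (Finset.mem_univ e)).trans
    (le_add_of_nonneg_right (Finset.sum_nonneg fun s _ => (ha s).le))

/-- Here the competitor is the mixture's own truncation. The left side collects the estimates on
minority arms of probability at most `s`, minus a correction on the majority arms, and this controls
the estimates themselves. -/
theorem aux_regret_le [NeZero N] (hη : 0 < η) (hξ : ∀ t e i, 0 ≤ ξ t e i)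
    (hξ1 : ∀ t e, ∑ i, ξ t e i = 1) {n : ℕ} (hy : ∀ t < n, y t ∈ Set.Icc (0 : ℝ) 1)
    (hp : ∀ t < n, 0 < mygaProb T η γ ξ A y t (A t)) {s : ℝ} (hs : s ∈ mygaThresholds T γ) :
    ∑ t ∈ Finset.range n, (mygaMixAt T η γ ξ A y t (A t) -
      truncArms (mygaMajorityAt T η γ ξ A y t) s (mygaMixAt T η γ ξ A y t) (A t)) *
      mygaEst T η γ ξ A y t ≤
      Real.log (N + T) / η + η / 2 * ∑ t ∈ Finset.range n, mygaEst T η γ ξ A y t := by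
  refine sum_sub_mul_mygaEst_le hη hξ hξ1 hy hp _ ?_
  obtain ⟨hb, ha⟩ := mygaWeights_pos T η γ ξ A y n
  rw [← mygaWeights_aux]
  exact (Finset.single_le_sum (f := (mygaWeights T η γ ξ A y n).aux) (fun s _ => (ha s).le)
    hs).trans (le_add_of_nonneg_left (Finset.sum_nonneg fun e _ => (hb e).le))

end Hedge

/-! ### Controlling the loss estimates by the realized loss. -/

section Minority

/-- The tail sums of the coefficients average the moved masses to at most the number of arms. -/
theorem sum_coeff_mul_smallMass_le {K : ℕ} {M : Finset (Fin K)} {q : Fin K → ℝ}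
    (h : IsMajorityMix M q) (S : Finset ℝ) (c : ℝ → ℝ)
    (hc : ∀ x, 0 < x → ∑ s ∈ S.filter (fun s => x ≤ s), c s ≤ 1 / x) :
    ∑ s ∈ S, c s * smallMass M q s ≤ K := by
  have h1 : ∀ s, smallMass M q s =
      ∑ j ∈ Finset.univ.filter (fun j => j ∉ M), if q j ≤ s then q j else 0 := fun s => by
    rw [smallMass, ← Finset.filter_filter, Finset.sum_filter (fun j => q j ≤ s)]
  -- After exchanging the sums, a minority arm `j` contributes `q j` times the tail sum from `q j`,
  -- which is at most `1`.
  calc ∑ s ∈ S, c s * smallMass M q s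
      = ∑ j ∈ Finset.univ.filter (fun j => j ∉ M),
          q j * ∑ s ∈ S.filter (fun s => q j ≤ s), c s := by
        simp only [h1, Finset.mul_sum]
        rw [Finset.sum_comm]
        refine Finset.sum_congr rfl fun j _ => ?_
        rw [Finset.sum_filter]
        refine Finset.sum_congr rfl fun s _ => ?_
        split_ifs <;> ring
    _ ≤ ∑ j ∈ Finset.univ.filter (fun j => j ∉ M), 1 := by
        refine Finset.sum_le_sum fun j _ => ?_
        rcases (h.nonneg j).eq_or_lt with h0 | h0
        · rw [← h0, zero_mul]
          exact zero_le_one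
        · calc q j * _ ≤ q j * (1 / q j) := mul_le_mul_of_nonneg_left (hc _ h0) h0.le
            _ = 1 := mul_one_div_cancel h0.ne'
    _ ≤ ∑ j : Fin K, 1 := Finset.sum_le_sum_of_subset_of_nonneg (Finset.filter_subset _ _)
        fun _ _ _ => zero_le_one
    _ = K := by simp

/-- On a majority arm `y / p ≤ 2 * K * y`, and the correction for received mass is at most `2 * K *
y`, counted twice: together `6 * K`. A minority arm that survives truncation has `γ < q i ≤ 1 / 2`,
so the tail sum from `q i` is at least `1 / (2 * q i)` and the average returns at least half of the
estimate. -/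
theorem est_le {K : ℕ} {M : Finset (Fin K)} {q : Fin K → ℝ}
    (h : IsMajorityMix M q) (S : Finset ℝ) (c : ℝ → ℝ) {γ : ℝ}
    (hc : ∀ x, 0 < x → ∑ s ∈ S.filter (fun s => x ≤ s), c s ≤ 1 / x)
    (hc' : ∀ x, γ < x → x ≤ 1 / 2 →
        1 / (2 * x) ≤ ∑ s ∈ S.filter (fun s => x ≤ s), c s)
    (hγ : 0 < γ) {i : Fin K} {y : ℝ} (hy : 0 ≤ y) (hp : 0 < truncArms M γ q i) :
    y / truncArms M γ q i ≤ 6 * K * y +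
      2 * ∑ s ∈ S, c s * ((q i - truncArms M s q i) * (y / truncArms M γ q i)) := by
  obtain ⟨hle, hlt⟩ := h.of_truncArms_pos hp
  have hz : 0 ≤ y / truncArms M γ q i := by positivity
  have hqz : q i * (y / truncArms M γ q i) ≤ y := by
    rw [mul_div_assoc', div_le_iff₀ hp, mul_comm]
    exact mul_le_mul_of_nonneg_left hle hy
  set z := y / truncArms M γ q i
  have hK : (0 : ℝ) < K := by exact_mod_cast i.pos
  by_cases hi : i ∈ M
  · have h1 : ∑ s ∈ S, c s * ((q i - truncArms M s q i) * z) =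
        -((q i * z) * (∑ s ∈ S, c s * smallMass M q s) / ∑ j ∈ M, q j) := by
      rw [Finset.mul_sum, Finset.sum_div, ← Finset.sum_neg_distrib]
      refine Finset.sum_congr rfl fun s _ => ?_
      rw [truncArms_of_mem hi]
      ring
    have h2 : (q i * z) * (∑ s ∈ S, c s * smallMass M q s) / ∑ j ∈ M, q j ≤ 2 * (K * y) := by
      rw [div_le_iff₀ h.sum_pos]
      have h3 := mul_le_mul_of_nonneg_left (sum_coeff_mul_smallMass_le h S c hc)
        (mul_nonneg (h.nonneg i) hz)
      have h4 : q i * z * K ≤ y * K := mul_le_mul_of_nonneg_right hqz hK.le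
      have h5 : K * y * (1 / 2) ≤ K * y * ∑ j ∈ M, q j :=
        mul_le_mul_of_nonneg_left h.half_le (by positivity)
      linarith
    have h3 : z ≤ 2 * K * (q i * z) := by
      have := mul_le_mul_of_nonneg_right (h.le_of_mem i hi) hz
      rw [div_mul_eq_mul_div, div_le_iff₀ (by positivity)] at this
      linarith
    have h4 : 2 * K * (q i * z) ≤ 2 * K * y := mul_le_mul_of_nonneg_left hqz (by positivity)
    rw [h1]
    linarith
  · have hq0 : 0 < q i := hγ.trans (hlt hi)
    have h1 : ∑ s ∈ S, c s * ((q i - truncArms M s q i) * z) =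
        (q i * z) * ∑ s ∈ S.filter (fun s => q i ≤ s), c s := by
      rw [Finset.mul_sum, Finset.sum_filter]
      refine Finset.sum_congr rfl fun s _ => ?_
      rw [truncArms_of_notMem hi]
      split_ifs <;> ring
    have h2 := mul_le_mul_of_nonneg_left (hc' _ (hlt hi) (h.le_half hi))
      (mul_nonneg hq0.le hz)
    have h3 : q i * z * (1 / (2 * q i)) = z / 2 := by field_simp
    have h4 : 0 ≤ 6 * K * y := by positivity
    rw [h1]
    linarith

variable {N K T : ℕ} {η γ : ℝ} {ξ : ℕ → Fin N → Fin K → ℝ} {A : ℕ → Fin K} {y : ℕ → ℝ}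

/-- The sum of the loss estimates of MYGA is controlled by the realized loss. -/
theorem sum_mygaEst_le [NeZero N] (hT : 0 < T) (hη : 0 < η) (hγ : γ = 2 * η)
    (hγT : 1 / (2 * T) ≤ γ) (hξ : ∀ t e i, 0 ≤ ξ t e i)
    (hξ1 : ∀ t e, ∑ i, ξ t e i = 1) (hy : ∀ t < T, y t ∈ Set.Icc (0 : ℝ) 1)
    (hp : ∀ t < T, 0 < mygaProb T η γ ξ A y t (A t)) :
    ∑ t ∈ Finset.range T, mygaEst T η γ ξ A y t ≤
      12 * K * ∑ t ∈ Finset.range T, y t + 2 * Real.log (N + T) / η ^ 2 := by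
  have hγ0 : 0 < γ := by linarith
  obtain ⟨c, hc0, hc, hc'⟩ := exists_threshold_coeff hT hγ0 hγT
  set Z := ∑ t ∈ Finset.range T, mygaEst T η γ ξ A y t with hZ
  have hZ0 : 0 ≤ Z := Finset.sum_nonneg fun t ht =>
    mygaEst_nonneg hξ hξ1 (hy t (Finset.mem_range.1 ht)).1
  have hlog : 0 ≤ Real.log (N + T) := by
    refine Real.log_nonneg ?_
    have : (1 : ℝ) ≤ N := by exact_mod_cast NeZero.one_le (n := N)
    linarith [(Nat.cast_nonneg T : (0 : ℝ) ≤ T)]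
  set H := Real.log (N + T) / η + η / 2 * Z with hH
  have hH0 : 0 ≤ H := by positivity
  have h1 : Z ≤ 6 * K * ∑ t ∈ Finset.range T, y t + 2 * ∑ s ∈ mygaThresholds T γ, c s *
      ∑ t ∈ Finset.range T, (mygaMixAt T η γ ξ A y t (A t) -
      truncArms (mygaMajorityAt T η γ ξ A y t) s (mygaMixAt T η γ ξ A y t) (A t)) *
      mygaEst T η γ ξ A y t := by
    simp only [Finset.mul_sum (Finset.range T)]
    rw [Finset.sum_comm, Finset.mul_sum, ← Finset.sum_add_distrib]
    refine Finset.sum_le_sum fun t ht => ?_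
    rw [Finset.mem_range] at ht
    exact est_le (isMajorityMix_mygaMixAt hξ hξ1 t) _ c hc hc' hγ0 (hy t ht).1 (hp t ht)
  have h2 : ∑ s ∈ mygaThresholds T γ, c s * ∑ t ∈ Finset.range T,
      (mygaMixAt T η γ ξ A y t (A t) -
      truncArms (mygaMajorityAt T η γ ξ A y t) s (mygaMixAt T η γ ξ A y t) (A t)) *
      mygaEst T η γ ξ A y t ≤ 1 / γ * H := by
    calc _ ≤ ∑ s ∈ mygaThresholds T γ, c s * H := Finset.sum_le_sum fun s hs =>
          mul_le_mul_of_nonneg_left (aux_regret_le hη hξ hξ1 hy hp hs) (hc0 s hs)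
      _ = (∑ s ∈ mygaThresholds T γ, c s) * H := by rw [Finset.sum_mul]
      _ ≤ _ := by
        refine mul_le_mul_of_nonneg_right ?_ hH0
        have := hc γ hγ0
        rwa [Finset.filter_true_of_mem] at this
        intro s hs
        obtain ⟨-, -, -, h⟩ := mem_mygaThresholds.1 hs
        exact h.le
  -- All thresholds exceed `γ`, so the coefficients have total mass at most `1 / γ`. The choice `γ =
  -- 2 * η` makes the variance part exactly `Z / 2`, which is absorbed on the left.
  have h3 : 2 * (1 / γ * H) = Real.log (N + T) / η ^ 2 + Z / 2 := by
    rw [hH, hγ]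
    field_simp
  have h4 : 2 * Real.log (N + T) / η ^ 2 = 2 * (Real.log (N + T) / η ^ 2) := by ring
  rw [h4]
  linarith

/-- The pathwise first-order regret bound of MYGA in terms of the loss estimates. -/
theorem sum_loss_le_of_mygaProb_pos [NeZero N] (hT : 0 < T) (hη : 0 < η) (hγ : γ = 2 * η)
    (hγT : 1 / (2 * T) ≤ γ) (hKη : K * η ≤ 1 / 20) (hξ : ∀ t e i, 0 ≤ ξ t e i)
    (hξ1 : ∀ t e, ∑ i, ξ t e i = 1) (hy : ∀ t < T, y t ∈ Set.Icc (0 : ℝ) 1)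
    (hp : ∀ t < T, 0 < mygaProb T η γ ξ A y t (A t)) (e : Fin N) :
    ∑ t ∈ Finset.range T, y t ≤ (1 + 18 * (K * η)) *
      (∑ t ∈ Finset.range T, ξ t e (A t) * mygaEst T η γ ξ A y t +
        2 * (Real.log (N + T) / η)) := by
  have hZ := sum_mygaEst_le hT hη hγ hγT hξ hξ1 hy hp
  have hreg := base_regret_le hη hξ hξ1 hy hp e
  -- The realized loss is `p * z`, and `p ≤ (1 + 2 * K * γ) * q` with `γ = 2 * η`.
  have hYG : ∑ t ∈ Finset.range T, y t ≤ (1 + 4 * (K * η)) *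
      ∑ t ∈ Finset.range T, mygaMixAt T η γ ξ A y t (A t) * mygaEst T η γ ξ A y t := by
    rw [Finset.mul_sum]
    refine Finset.sum_le_sum fun t ht => ?_
    rw [Finset.mem_range] at ht
    have hmix := isMajorityMix_mygaMixAt (T := T) (η := η) (γ := γ) (A := A) (y := y) hξ hξ1 t
    have h1 := hmix.truncArms_le (s := γ) (by linarith) (A t)
    have h2 := hp t ht
    rw [← mygaProb_eq] at h1
    rw [mygaEst, mul_div_assoc', mul_div_assoc', le_div_iff₀ h2]
    have h3 : 1 + 4 * (K * η) = 1 + 2 * K * γ := by rw [hγ]; ring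
    have h4 := mul_le_mul_of_nonneg_left h1 (hy t ht).1
    rw [h3]
    linarith
  simp only [sub_mul, Finset.sum_sub_distrib] at hreg
  have hlog : 0 ≤ Real.log (N + T) / η := by
    refine div_nonneg (Real.log_nonneg ?_) hη.le
    have : (1 : ℝ) ≤ N := by exact_mod_cast NeZero.one_le (n := N)
    linarith [(Nat.cast_nonneg T : (0 : ℝ) ≤ T)]
  have hE : 0 ≤ ∑ t ∈ Finset.range T, ξ t e (A t) * mygaEst T η γ ξ A y t :=
    Finset.sum_nonneg fun t ht => mul_nonneg (hξ _ _ _)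
      (mygaEst_nonneg hξ hξ1 (hy t (Finset.mem_range.1 ht)).1)
  set Y := ∑ t ∈ Finset.range T, y t
  set Z := ∑ t ∈ Finset.range T, mygaEst T η γ ξ A y t
  set G := ∑ t ∈ Finset.range T, mygaMixAt T η γ ξ A y t (A t) * mygaEst T η γ ξ A y t
  set E := ∑ t ∈ Finset.range T, ξ t e (A t) * mygaEst T η γ ξ A y t
  set Λ := Real.log (N + T) / η with hΛ
  set u := (K : ℝ) * η with hu
  have hu0 : 0 ≤ u := by positivity
  have h5 : η / 2 * Z ≤ 6 * u * Y + Λ := by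
    have := mul_le_mul_of_nonneg_left hZ (by positivity : 0 ≤ η / 2)
    have h6 : η / 2 * (12 * K * Y + 2 * Real.log (N + T) / η ^ 2) = 6 * u * Y + Λ := by
      rw [hu, hΛ]
      field_simp
      ring
    linarith
  have h6 : Y ≤ (1 + 4 * u) * (E + 2 * Λ + 6 * u * Y) :=
    hYG.trans (mul_le_mul_of_nonneg_left (by linarith) (by linarith))
  have hY0 : 0 ≤ Y := Finset.sum_nonneg fun t ht => (hy t (Finset.mem_range.1 ht)).1
  -- Solving for `Y`: with `u ≤ 1 / 20` the coefficient `6 * u * (1 + 4 * u)` is at most `36 / 5 *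
  -- u`. The same bound on `u` lets `1 + 18 * u` dominate the quotient `(1 + 4 * u) / (1 - 36 / 5 *
  -- u)`.
  have h7 : (1 - 36 / 5 * u) * Y ≤ (1 + 4 * u) * (E + 2 * Λ) := by
    nlinarith [mul_nonneg hu0 hY0, mul_nonneg (mul_nonneg hu0 hY0) (sub_nonneg.2 hKη)]
  have h8 : (1 + 4 * u) ≤ (1 - 36 / 5 * u) * (1 + 18 * u) := by
    nlinarith [mul_nonneg hu0 (sub_nonneg.2 hKη)]
  have h9 : (1 - 36 / 5 * u) * Y ≤ (1 - 36 / 5 * u) * ((1 + 18 * u) * (E + 2 * Λ)) := by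
    have h10 := mul_le_mul_of_nonneg_right h8 (by linarith : 0 ≤ E + 2 * Λ)
    rw [mul_assoc (1 - 36 / 5 * u)] at h10
    exact h7.trans h10
  exact le_of_mul_le_mul_left h9 (by linarith)

end Minority

/-! ### Conditional expectation of importance weighted losses. -/

section ImportanceWeighting

variable {Ω : Type*} {m mΩ : MeasurableSpace Ω} {μ : Measure Ω} [IsProbabilityMeasure μ]

/-- An event whose conditional probability vanishes almost surely does not happen. -/
theorem ae_pos_of_condExp_indicator (hm : m ≤ mΩ) {B : Set Ω} (hB : MeasurableSet B)
    {p : Ω → ℝ} (hp : μ[B.indicator (fun _ => (1 : ℝ)) | m] =ᵐ[μ] p) (hp0 : ∀ᵐ ω ∂μ, 0 ≤ p ω) :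
    ∀ᵐ ω ∂μ, ω ∈ B → 0 < p ω := by
  have hint : Integrable (B.indicator fun _ => (1 : ℝ)) μ :=
    (integrable_const (1 : ℝ)).indicator hB
  set g := μ[B.indicator (fun _ => (1 : ℝ)) | m] with hg
  have hgm : Measurable[m] g := stronglyMeasurable_condExp.measurable
  have hs : MeasurableSet[m] (g ⁻¹' {0}) := hgm (measurableSet_singleton 0)
  -- The event that the conditional probability vanishes is `m`-measurable, so its intersection with
  -- `B` has measure equal to the integral of `g` over it, which is `0`.
  have h1 := setIntegral_condExp hm hint hs
  have h2 : ∫ ω in g ⁻¹' {0}, g ω ∂μ = 0 :=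
    setIntegral_eq_zero_of_forall_eq_zero fun ω hω => hω
  rw [← hg, h2, setIntegral_indicator hB, setIntegral_const, smul_eq_mul, mul_one,
    eq_comm, measureReal_eq_zero_iff] at h1
  have h3 : ∀ᵐ ω ∂μ, ω ∉ g ⁻¹' {0} ∩ B := measure_eq_zero_iff_ae_notMem.1 h1
  filter_upwards [h3, hp, hp0] with ω h4 h5 h6 hω
  refine h6.lt_of_ne fun h7 => h4 ⟨?_, hω⟩
  rw [Set.mem_preimage, h5, ← h7]
  rfl

/-- Importance weighting does not increase the expectation of a nonnegative function. -/
theorem integral_indicator_div_le (hm : m ≤ mΩ) {B : Set Ω} (hB : MeasurableSet B)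
    {p f : Ω → ℝ} {δ : ℝ} (hp : μ[B.indicator (fun _ => (1 : ℝ)) | m] =ᵐ[μ] p)
    (hδ : 0 < δ) (hp0 : ∀ᵐ ω ∂μ, 0 ≤ p ω ∧ (0 < p ω → δ ≤ p ω))
    (hf : Measurable[m] f) (hf01 : ∀ᵐ ω ∂μ, f ω ∈ Set.Icc (0 : ℝ) 1) :
    Integrable (fun ω => B.indicator (fun _ => (1 : ℝ)) ω * (f ω / p ω)) μ ∧
      ∫ ω, B.indicator (fun _ => (1 : ℝ)) ω * (f ω / p ω) ∂μ ≤ ∫ ω, f ω ∂μ := by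
  have hint : Integrable (B.indicator fun _ => (1 : ℝ)) μ :=
    (integrable_const (1 : ℝ)).indicator hB
  set g := μ[B.indicator (fun _ => (1 : ℝ)) | m] with hg
  have hgm : Measurable[m] g := stronglyMeasurable_condExp.measurable
  -- Only the version `g` of `p` is known to be `m`-measurable, so `f / g` is the factor to pull
  -- out.
  have hfg : StronglyMeasurable[m] (f / g) := (hf.div hgm).stronglyMeasurable
  have hbound : ∀ᵐ ω ∂μ, ‖(f / g) ω‖ ≤ 1 / δ := by
    filter_upwards [hp, hp0, hf01] with ω h1 h2 h3
    rw [Pi.div_apply, h1, Real.norm_eq_abs, abs_of_nonneg (div_nonneg h3.1 h2.1)]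
    rcases h2.1.eq_or_lt with h0 | h0
    · rw [← h0, div_zero]
      positivity
    · exact div_le_div₀ zero_le_one h3.2 hδ (h2.2 h0)
  have heq : (fun ω => B.indicator (fun _ => (1 : ℝ)) ω * (f ω / p ω)) =ᵐ[μ]
      (f / g) * B.indicator fun _ => (1 : ℝ) := by
    filter_upwards [hp] with ω h1
    rw [Pi.mul_apply, Pi.div_apply, h1, mul_comm]
  have hprod : Integrable ((f / g) * B.indicator fun _ => (1 : ℝ)) μ :=
    hint.bdd_mul (hfg.mono hm).aestronglyMeasurable hbound
  refine ⟨hprod.congr heq.symm, ?_⟩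
  have hfi : Integrable f μ := by
    refine Integrable.of_bound (hf.mono hm le_rfl).aestronglyMeasurable 1 ?_
    filter_upwards [hf01] with ω h
    rw [Real.norm_eq_abs, abs_of_nonneg h.1]
    exact h.2
  rw [integral_congr_ae heq, ← integral_condExp hm]
  have hpull := condExp_mul_of_stronglyMeasurable_left hfg hprod hint
  refine integral_mono_ae integrable_condExp hfi ?_
  filter_upwards [hpull, hp, hp0, hf01] with ω h1 h2 h3 h4
  rw [h1, Pi.mul_apply, Pi.div_apply]
  -- Where `g` vanishes the quotient is `0` by convention and the mass of `f` is lost; this is why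
  -- only an inequality holds.
  by_cases h0 : g ω = 0
  · change f ω / g ω * g ω ≤ f ω
    rw [h0, mul_zero]
    exact h4.1
  · exact (div_mul_cancel₀ _ h0).le

end ImportanceWeighting

/-! ### Linear classifiers and their measurability. -/

section Classifier

variable {K d : ℕ} [NeZero K]

theorem inner_linClassifier_le (β : Fin K → EuclideanSpace ℝ (Fin d))
    (x : EuclideanSpace ℝ (Fin d)) (b : Fin K) :
    inner ℝ x (β (linClassifier β x)) ≤ inner ℝ x (β b) :=
  (Finset.mem_filter.1 (Finset.min'_mem (Finset.univ.filter fun a => ∀ b,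
    inner ℝ x (β a) ≤ inner ℝ x (β b)) _)).2 b

theorem linClassifier_eq_iff (β : Fin K → EuclideanSpace ℝ (Fin d))
    (x : EuclideanSpace ℝ (Fin d)) (a : Fin K) : linClassifier β x = a ↔
    (∀ b, inner ℝ x (β a) ≤ inner ℝ x (β b)) ∧
      ∀ a', a' < a → ¬ ∀ b, inner ℝ x (β a') ≤ inner ℝ x (β b) := by
  have hle : ∀ a', (∀ b, inner ℝ x (β a') ≤ inner ℝ x (β b)) → linClassifier β x ≤ a' :=
    fun a' h => Finset.min'_le _ _ (by simpa using h)
  constructor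
  · rintro rfl
    exact ⟨inner_linClassifier_le β x, fun a' h h' => absurd (hle a' h') (not_le.2 h)⟩
  · rintro ⟨h1, h2⟩
    refine le_antisymm (hle a h1) ?_
    by_contra! h
    exact h2 _ h (inner_linClassifier_le β x)

theorem measurable_linClassifier (β : Fin K → EuclideanSpace ℝ (Fin d)) :
    Measurable (linClassifier β) := by
  refine measurable_to_countable' fun a => ?_
  have h : ∀ a b, MeasurableSet {x : EuclideanSpace ℝ (Fin d) |
      inner ℝ x (β a) ≤ inner ℝ x (β b)} := fun a b =>
    measurableSet_le (by fun_prop) (by fun_prop)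
  have h' : ∀ a, MeasurableSet {x : EuclideanSpace ℝ (Fin d) |
      ∀ b, inner ℝ x (β a) ≤ inner ℝ x (β b)} := fun a => by
    simp only [Set.ofPred_forall]
    exact MeasurableSet.iInter fun b => h a b
  have : linClassifier β ⁻¹' {a} = {x | ∀ b, inner ℝ x (β a) ≤ inner ℝ x (β b)} ∩
      ⋂ a' ∈ {a' | a' < a}, {x | ∀ b, inner ℝ x (β a') ≤ inner ℝ x (β b)}ᶜ := by
    ext x
    simp only [Set.mem_preimage, Set.mem_singleton_iff, linClassifier_eq_iff, Set.mem_inter_iff,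
      Set.mem_iInter, Set.mem_compl_iff, Set.mem_ofPred_eq]
  rw [this]
  exact (h' a).inter (MeasurableSet.biInter (Set.to_countable _) fun a' _ => (h' a').compl)

theorem classifierAdvice_nonneg (β : Fin K → EuclideanSpace ℝ (Fin d))
    (x : EuclideanSpace ℝ (Fin d)) (i : Fin K) : 0 ≤ classifierAdvice β x i := by
  rw [classifierAdvice, Pi.single_apply]
  split_ifs <;> norm_num

theorem sum_classifierAdvice (β : Fin K → EuclideanSpace ℝ (Fin d))
    (x : EuclideanSpace ℝ (Fin d)) : ∑ i, classifierAdvice β x i = 1 := by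
  simp [classifierAdvice]

theorem classifierAdvice_le_one (β : Fin K → EuclideanSpace ℝ (Fin d))
    (x : EuclideanSpace ℝ (Fin d)) (i : Fin K) : classifierAdvice β x i ≤ 1 := by
  rw [classifierAdvice, Pi.single_apply]
  split_ifs <;> norm_num

theorem measurable_classifierAdvice_mul_inner (β : Fin K → EuclideanSpace ℝ (Fin d)) (i : Fin K) :
    Measurable fun z : (Fin K → EuclideanSpace ℝ (Fin d)) × EuclideanSpace ℝ (Fin d) =>
      classifierAdvice β z.2 i * (inner ℝ z.2 (z.1 i) : ℝ) := by
  have hadv : Measurable fun x : EuclideanSpace ℝ (Fin d) => classifierAdvice β x i :=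
    (measurable_of_finite fun a : Fin K => (Pi.single a 1 : Fin K → ℝ) i).comp
      (measurable_linClassifier β)
  exact (hadv.comp measurable_snd).mul
    (measurable_snd.inner ((measurable_pi_apply i).comp measurable_fst))

end Classifier

/-! ### Losses of fixed policies and approximation by a cover. -/

section Policies

variable {Ω : Type*} [MeasurableSpace Ω] {K d T : ℕ} {μ : Measure Ω}
  {D : Measure (EuclideanSpace ℝ (Fin d))} {X : ℕ → Ω → EuclideanSpace ℝ (Fin d)}
  {θ : ℕ → Ω → Fin K → EuclideanSpace ℝ (Fin d)} {A : ℕ → Ω → Fin K} {p : ℕ → Ω → Fin K → ℝ}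
  {σ R : ℝ}

theorem measurable_apply_index {α : Type*} [MeasurableSpace α] {E : Type*} [MeasurableSpace E]
    {f : α → Fin K → E} {g : α → Fin K} (hf : Measurable f) (hg : Measurable g) :
    Measurable fun x => f x (g x) := by
  have : Measurable fun z : (Fin K → E) × Fin K => z.1 z.2 :=
    measurable_from_prod_countable_left fun a => measurable_pi_apply a
  exact this.comp (hf.prodMk hg)

/-- It places the parameter that determines the loss of every policy in the ball that is covered. -/
theorem norm_sum_integral_param_le [IsProbabilityMeasure μ]
    (hR : ∀ t < T, ∀ i, ∀ᵐ ω ∂μ, ‖θ t ω i‖ ≤ R) (a : Fin K) :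
    ‖∑ t ∈ Finset.range T, ∫ ω, θ t ω a ∂μ‖ ≤ R * T := by
  calc _ ≤ ∑ t ∈ Finset.range T, R := norm_sum_le_of_le _ fun t ht => by
        have := norm_integral_le_of_norm_le_const (hR t (Finset.mem_range.1 ht) a)
        simpa using this
    _ = R * T := by simp [mul_comm]

theorem policyLoss_nonneg
    (hloss : ∀ t < T, ∀ i, ∀ᵐ ω ∂μ, banditLoss X θ t ω i ∈ Set.Icc (0 : ℝ) 1)
    (π : EuclideanSpace ℝ (Fin d) → Fin K) : 0 ≤ policyLoss T μ X θ π := by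
  refine integral_nonneg_of_ae ?_
  have : ∀ᵐ ω ∂μ, ∀ t ∈ Finset.range T, ∀ i, banditLoss X θ t ω i ∈ Set.Icc (0 : ℝ) 1 :=
    (ae_ball_iff (Set.to_countable _)).2 fun t ht =>
      ae_all_iff.2 (hloss t (Finset.mem_range.1 ht))
  filter_upwards [this] with ω hω
  exact Finset.sum_nonneg fun t ht => (hω t ht _).1

theorem optLoss_nonneg
    (hloss : ∀ t < T, ∀ i, ∀ᵐ ω ∂μ, banditLoss X θ t ω i ∈ Set.Icc (0 : ℝ) 1) :
    0 ≤ optLoss T μ X θ :=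
  Real.iInf_nonneg fun π => policyLoss_nonneg hloss π.1

namespace IsBanditInteraction

variable (h : IsBanditInteraction T D μ X θ A p)

include h

theorem isProbabilityMeasure [IsProbabilityMeasure μ] (hT : 0 < T) : IsProbabilityMeasure D := by
  rw [← h.context_law 0 hT]
  exact Measure.isProbabilityMeasure_map (h.measurable_context 0 hT).aemeasurable

theorem ae_norm_context_le (hσ : ∀ᵐ x ∂D, ‖x‖ ≤ σ) {t : ℕ} (ht : t < T) :
    ∀ᵐ ω ∂μ, ‖X t ω‖ ≤ σ := by
  rw [← h.context_law t ht] at hσ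
  exact ae_of_ae_map (h.measurable_context t ht).aemeasurable hσ

theorem measurable_loss {t : ℕ} (ht : t < T) {a : Ω → Fin K} (ha : Measurable a) :
    Measurable fun ω => banditLoss X θ t ω (a ω) :=
  (h.measurable_context t ht).inner (measurable_apply_index (h.measurable_param t ht) ha)

theorem integrable_param [IsProbabilityMeasure μ]
    (hR : ∀ t < T, ∀ i, ∀ᵐ ω ∂μ, ‖θ t ω i‖ ≤ R) {t : ℕ} (ht : t < T)
    (a : Fin K) : Integrable (fun ω => θ t ω a) μ :=
  Integrable.of_bound ((measurable_pi_apply a).comp (h.measurable_param t ht)).aestronglyMeasurable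
    R (hR t ht a)

/-- The expected loss of a policy in one round, by independence of context and parameters. -/
theorem integral_loss_policy [IsProbabilityMeasure μ] (hσ : ∀ᵐ x ∂D, ‖x‖ ≤ σ)
    (hR : ∀ t < T, ∀ i, ∀ᵐ ω ∂μ, ‖θ t ω i‖ ≤ R) {t : ℕ} (ht : t < T)
    {π : EuclideanSpace ℝ (Fin d) → Fin K} (hπ : Measurable π) :
    ∫ ω, banditLoss X θ t ω (π (X t ω)) ∂μ =
      ∫ x, inner ℝ x (∫ ω, θ t ω (π x) ∂μ) ∂D := by
  have hX := h.measurable_context t ht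
  have hθ := h.measurable_param t ht
  -- Only independence within the round is needed, so the environment may adapt to the past; Fubini
  -- then replaces the parameters by their expectations.
  have hXθ : IndepFun (X t) (θ t) μ := (h.context_indep t ht).comp measurable_id measurable_snd
  have hprod := (indepFun_iff_map_prod_eq_prod_map_map hX.aemeasurable hθ.aemeasurable).1 hXθ
  rw [h.context_law t ht] at hprod
  have := h.isProbabilityMeasure (by omega)
  have := Measure.isProbabilityMeasure_map (μ := μ) hθ.aemeasurable
  let F : EuclideanSpace ℝ (Fin d) × (Fin K → EuclideanSpace ℝ (Fin d)) → ℝ :=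
    fun z => inner ℝ z.1 (z.2 (π z.1))
  have hF : Measurable F :=
    measurable_fst.inner (measurable_apply_index measurable_snd (hπ.comp measurable_fst))
  have hFi : Integrable F (μ.map fun ω => (X t ω, θ t ω)) := by
    rw [integrable_map_measure hF.aestronglyMeasurable (hX.prodMk hθ).aemeasurable]
    refine Integrable.of_bound (hF.comp (hX.prodMk hθ)).aestronglyMeasurable (σ * R) ?_
    filter_upwards [h.ae_norm_context_le hσ ht, ae_all_iff.2 (hR t ht)] with ω h1 h2
    refine (norm_inner_le_norm _ _).trans ?_
    exact mul_le_mul h1 (h2 _) (norm_nonneg _) ((norm_nonneg _).trans h1)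
  calc ∫ ω, banditLoss X θ t ω (π (X t ω)) ∂μ
      = ∫ z, F z ∂(μ.map fun ω => (X t ω, θ t ω)) :=
        (integral_map (hX.prodMk hθ).aemeasurable hF.aestronglyMeasurable).symm
    _ = ∫ x, ∫ ϑ, F (x, ϑ) ∂(μ.map (θ t)) ∂D := by
        rw [hprod] at hFi ⊢
        exact integral_prod F hFi
    _ = _ := by
        refine integral_congr_ae (Filter.Eventually.of_forall fun x => ?_)
        have hm : AEStronglyMeasurable (fun ϑ : Fin K → EuclideanSpace ℝ (Fin d) => ϑ (π x))
            (μ.map (θ t)) := (measurable_pi_apply (π x)).aestronglyMeasurable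
        change ∫ ϑ, inner ℝ x (ϑ (π x)) ∂(μ.map (θ t)) = inner ℝ x (∫ ω, θ t ω (π x) ∂μ)
        rw [← integral_map hθ.aemeasurable hm]
        refine integral_inner ?_ x
        rw [integrable_map_measure hm hθ.aemeasurable]
        exact h.integrable_param hR ht (π x)

theorem integrable_loss [IsProbabilityMeasure μ]
    (hloss : ∀ t < T, ∀ i, ∀ᵐ ω ∂μ, banditLoss X θ t ω i ∈ Set.Icc (0 : ℝ) 1)
    {t : ℕ} (ht : t < T) {a : Ω → Fin K} (ha : Measurable a) :
    Integrable (fun ω => banditLoss X θ t ω (a ω)) μ := by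
  refine Integrable.of_bound (h.measurable_loss ht ha).aestronglyMeasurable 1 ?_
  filter_upwards [ae_all_iff.2 (hloss t ht)] with ω hω
  rw [Real.norm_eq_abs, abs_of_nonneg (hω _).1]
  exact (hω _).2

theorem integrable_inner_policy [IsProbabilityMeasure μ] (hT : 0 < T) (hσ : ∀ᵐ x ∂D, ‖x‖ ≤ σ)
    {π : EuclideanSpace ℝ (Fin d) → Fin K} (hπ : Measurable π)
    (b : Fin K → EuclideanSpace ℝ (Fin d)) : Integrable (fun x => inner ℝ x (b (π x))) D := by
  have := h.isProbabilityMeasure hT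
  have hb : Measurable fun x => b (π x) := (measurable_of_finite b).comp hπ
  refine Integrable.of_bound (measurable_id.inner hb).aestronglyMeasurable (σ * ∑ a, ‖b a‖) ?_
  filter_upwards [hσ] with x hx
  refine (norm_inner_le_norm _ _).trans (mul_le_mul hx ?_ (norm_nonneg _)
    ((norm_nonneg _).trans hx))
  exact Finset.single_le_sum (f := fun a => ‖b a‖) (fun a _ => norm_nonneg _)
    (Finset.mem_univ (π x))

/-- The loss of a policy depends on the parameters only through their expected sum. -/
theorem policyLoss_eq [IsProbabilityMeasure μ] (hT : 0 < T) (hσ : ∀ᵐ x ∂D, ‖x‖ ≤ σ)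
    (hR : ∀ t < T, ∀ i, ∀ᵐ ω ∂μ, ‖θ t ω i‖ ≤ R)
    (hloss : ∀ t < T, ∀ i, ∀ᵐ ω ∂μ, banditLoss X θ t ω i ∈ Set.Icc (0 : ℝ) 1)
    {π : EuclideanSpace ℝ (Fin d) → Fin K} (hπ : Measurable π) :
    policyLoss T μ X θ π =
      ∫ x, inner ℝ x (∑ t ∈ Finset.range T, ∫ ω, θ t ω (π x) ∂μ) ∂D := by
  rw [policyLoss, integral_finsetSum]
  · simp only [inner_sum]
    rw [integral_finsetSum]
    · exact Finset.sum_congr rfl fun t ht =>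
        h.integral_loss_policy hσ hR (Finset.mem_range.1 ht) hπ
    · intro t _
      exact h.integrable_inner_policy hT hσ hπ fun a => ∫ ω, θ t ω a ∂μ
  · intro t ht
    rw [Finset.mem_range] at ht
    exact h.integrable_loss hloss ht (hπ.comp (h.measurable_context t ht))

/-- Some linear classifier of a cover is nearly optimal among all policies. -/
theorem exists_linClassifier_policyLoss_le [NeZero K] [IsProbabilityMeasure μ] {N : ℕ}
    {ε : ℝ} (hT : 0 < T)
    (hσ : ∀ᵐ x ∂D, ‖x‖ ≤ σ) (hR : ∀ t < T, ∀ i, ∀ᵐ ω ∂μ, ‖θ t ω i‖ ≤ R)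
    (hloss : ∀ t < T, ∀ i, ∀ᵐ ω ∂μ, banditLoss X θ t ω i ∈ Set.Icc (0 : ℝ) 1)
    {β : Fin N → Fin K → EuclideanSpace ℝ (Fin d)} (hβ : IsParamCover (R * T) ε β) :
    ∃ j, policyLoss T μ X θ (linClassifier (β j)) ≤ optLoss T μ X θ + 2 * σ * ε := by
  have := h.isProbabilityMeasure hT
  set b : Fin K → EuclideanSpace ℝ (Fin d) := fun a => ∑ t ∈ Finset.range T, ∫ ω, θ t ω a ∂μ
    with hb
  obtain ⟨j, hj⟩ := hβ b fun a => norm_sum_integral_param_le hR a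
  refine ⟨j, ?_⟩
  rw [← sub_le_iff_le_add]
  have : Nonempty {π : EuclideanSpace ℝ (Fin d) → Fin K // Measurable π} :=
    ⟨⟨fun _ => 0, measurable_const⟩⟩
  refine le_ciInf fun ⟨π, hπ⟩ => ?_
  have hm := measurable_linClassifier (β j)
  change _ ≤ policyLoss T μ X θ π
  rw [sub_le_iff_le_add, h.policyLoss_eq hT hσ hR hloss hm, h.policyLoss_eq hT hσ hR hloss hπ]
  have hi := h.integrable_inner_policy hT hσ hπ b
  calc ∫ x, inner ℝ x (b (linClassifier (β j) x)) ∂D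
      ≤ ∫ x, (inner ℝ x (b (π x)) + 2 * σ * ε) ∂D := by
        refine integral_mono_ae (h.integrable_inner_policy hT hσ hm b)
          (hi.add (integrable_const _)) ?_
        filter_upwards [hσ] with x hx
        -- The scores for `b` and for `β j` are exchanged twice, at the arm of the classifier and at
        -- the arm of `π`; in between, the classifier minimizes the score of `β j`.
        have hdiff : ∀ a, |inner ℝ x (b a) - inner ℝ x (β j a)| ≤ σ * ε := fun a => by
          rw [← inner_sub_right]
          exact (abs_real_inner_le_norm _ _).trans
            (mul_le_mul hx (hj a) (norm_nonneg _) ((norm_nonneg _).trans hx))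
        have h1 := abs_le.1 (hdiff (linClassifier (β j) x))
        have h2 := abs_le.1 (hdiff (π x))
        have h3 := inner_linClassifier_le (β j) x (π x)
        linarith [h1.2, h2.1]
    _ = ∫ x, inner ℝ x (b (π x)) ∂D + 2 * σ * ε := by
        rw [integral_add hi (integrable_const _)]
        simp

theorem learnerLoss_le [IsProbabilityMeasure μ]
    (hloss : ∀ t < T, ∀ i, ∀ᵐ ω ∂μ, banditLoss X θ t ω i ∈ Set.Icc (0 : ℝ) 1) :
    learnerLoss T μ X θ A ≤ T := by
  rw [learnerLoss, integral_finsetSum _ fun t ht => h.integrable_loss hloss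
    (Finset.mem_range.1 ht) (h.measurable_arm t (Finset.mem_range.1 ht))]
  calc _ ≤ ∑ t ∈ Finset.range T, (1 : ℝ) := Finset.sum_le_sum fun t ht => by
        rw [Finset.mem_range] at ht
        have := integral_mono_ae (h.integrable_loss hloss ht (h.measurable_arm t ht))
          (integrable_const (1 : ℝ)) (by
            filter_upwards [ae_all_iff.2 (hloss t ht)] with ω hω using (hω _).2)
        simpa using this
    _ = T := by simp

theorem comap_le {t : ℕ} (ht : t < T) :
    MeasurableSpace.comap (fun ω => (banditHistory X θ A t ω, θ t ω, X t ω)) inferInstance ≤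
      ‹MeasurableSpace Ω› := by
  refine Measurable.comap_le (Measurable.prodMk ?_
    ((h.measurable_param t ht).prodMk (h.measurable_context t ht)))
  exact measurable_pi_lambda _ fun s =>
    (h.measurable_context s (s.2.trans ht)).prodMk
      ((h.measurable_param s (s.2.trans ht)).prodMk (h.measurable_arm s (s.2.trans ht)))

/-- The importance weighted loss of a linear classifier has at most the expectation of its true
loss. -/
theorem integral_advice_mul_div_le [IsProbabilityMeasure μ] [NeZero K]
    (hloss : ∀ t < T, ∀ i, ∀ᵐ ω ∂μ, banditLoss X θ t ω i ∈ Set.Icc (0 : ℝ) 1) {δ : ℝ}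
    (hδ : 0 < δ) (hp : ∀ t ω i, 0 ≤ p t ω i ∧ (0 < p t ω i → δ ≤ p t ω i))
    {t : ℕ} (ht : t < T) (b : Fin K → EuclideanSpace ℝ (Fin d)) :
    Integrable (fun ω => classifierAdvice b (X t ω) (A t ω) *
      (banditLoss X θ t ω (A t ω) / p t ω (A t ω))) μ ∧
    ∫ ω, classifierAdvice b (X t ω) (A t ω) *
      (banditLoss X θ t ω (A t ω) / p t ω (A t ω)) ∂μ ≤
      ∫ ω, banditLoss X θ t ω (linClassifier b (X t ω)) ∂μ := by
  -- The loss counted when the classifier picks arm `i`. It is determined by the context and the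
  -- parameters, hence measurable before the arm is drawn; both sides are then split over the arms.
  let f : Fin K → Ω → ℝ := fun i ω => classifierAdvice b (X t ω) i * banditLoss X θ t ω i
  have hf : ∀ i, Measurable[MeasurableSpace.comap
      (fun ω => (banditHistory X θ A t ω, θ t ω, X t ω)) inferInstance] (f i) := fun i => by
    have h1 := comap_measurable (m := inferInstance)
      (fun ω => (banditHistory X θ A t ω, θ t ω, X t ω))
    have h2 := (measurable_classifierAdvice_mul_inner b i).comp (measurable_snd.comp h1)
    exact h2
  have hf01 : ∀ i, ∀ᵐ ω ∂μ, f i ω ∈ Set.Icc (0 : ℝ) 1 := fun i => by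
    filter_upwards [hloss t ht i] with ω hω
    exact ⟨mul_nonneg (classifierAdvice_nonneg _ _ _) hω.1,
      mul_le_one₀ (classifierAdvice_le_one _ _ _) hω.1 hω.2⟩
  have hkey := fun i => integral_indicator_div_le
    (h.comap_le ht) (h.measurable_arm t ht (measurableSet_singleton i)) (h.arm_law t ht i)
    hδ (Filter.Eventually.of_forall fun ω => hp t ω i) (hf i) (hf01 i)
  have hfi : ∀ i, Integrable (f i) μ := fun i => by
    refine Integrable.of_bound ((hf i).mono (h.comap_le ht) le_rfl).aestronglyMeasurable 1 ?_
    filter_upwards [hf01 i] with ω hω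
    rw [Real.norm_eq_abs, abs_of_nonneg hω.1]
    exact hω.2
  have hsum : (fun ω => classifierAdvice b (X t ω) (A t ω) *
      (banditLoss X θ t ω (A t ω) / p t ω (A t ω))) =
      fun ω => ∑ i, (A t ⁻¹' {i}).indicator (fun _ => (1 : ℝ)) ω * (f i ω / p t ω i) := by
    ext ω
    rw [Finset.sum_eq_single (A t ω)]
    · rw [Set.indicator_of_mem (by simp), one_mul, mul_div_assoc]
    · intro i _ hi
      rw [Set.indicator_of_notMem (by simpa using hi.symm), zero_mul]
    · simp
  have hsum' : (fun ω => banditLoss X θ t ω (linClassifier b (X t ω))) =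
      fun ω => ∑ i, f i ω := by
    ext ω
    rw [Finset.sum_eq_single (linClassifier b (X t ω))]
    · simp [f, classifierAdvice]
    · intro i _ hi
      simp [f, classifierAdvice, hi]
    · simp
  rw [hsum, hsum', integral_finsetSum _ fun i _ => (hkey i).1,
    integral_finsetSum _ fun i _ => hfi i]
  exact ⟨integrable_finsetSum _ fun i _ => (hkey i).1,
    Finset.sum_le_sum fun i _ => (hkey i).2⟩

end IsBanditInteraction

end Policies

/-! ### The regret bound in expectation. -/

section Regret

variable {Ω : Type*} {K d T N : ℕ} [NeZero K] [NeZero N]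
  {X : ℕ → Ω → EuclideanSpace ℝ (Fin d)}
  {θ : ℕ → Ω → Fin K → EuclideanSpace ℝ (Fin d)} {A : ℕ → Ω → Fin K}
  {β : Fin N → Fin K → EuclideanSpace ℝ (Fin d)} {η γ : ℝ}

theorem isMajorityMix_mygaLearner (t : ℕ) (ω : Ω) : ∃ M q, IsMajorityMix M q ∧
    mygaLearner T η γ β X θ A t ω = truncArms M γ q :=
  ⟨_, _, isMajorityMix_mygaMixAt (T := T) (η := η) (γ := γ)
    (ξ := fun s j => classifierAdvice (β j) (X s ω)) (A := fun s => A s ω)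
    (y := fun s => banditLoss X θ s ω (A s ω))
    (fun _ _ _ => classifierAdvice_nonneg _ _ _) (fun _ _ => sum_classifierAdvice _ _) t,
    mygaProb_eq _ _ _ _ _ _ t⟩

variable [MeasurableSpace Ω] {μ : Measure Ω} [IsProbabilityMeasure μ]
  {D : Measure (EuclideanSpace ℝ (Fin d))}

/-- The pathwise analysis divides by the probability of the played arm, so arms of conditional
probability zero must be excluded almost surely. -/
theorem mygaLearner_pos_ae (h : IsBanditInteraction T D μ X θ A (mygaLearner T η γ β X θ A))
    {t : ℕ} (ht : t < T) : ∀ᵐ ω ∂μ, 0 < mygaLearner T η γ β X θ A t ω (A t ω) := by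
  have h1 : ∀ a : Fin K, ∀ᵐ ω ∂μ, ω ∈ A t ⁻¹' {a} →
      0 < mygaLearner T η γ β X θ A t ω a := fun a =>
    ae_pos_of_condExp_indicator (h.comap_le ht) (h.measurable_arm t ht (measurableSet_singleton a))
      (h.arm_law t ht a) (Filter.Eventually.of_forall fun ω => by
        obtain ⟨M, q, hq, he⟩ := isMajorityMix_mygaLearner (T := T) (η := η) (γ := γ) (X := X)
          (θ := θ) (A := A) (β := β) t ω
        rw [he]
        exact hq.truncArms_nonneg γ a)
  filter_upwards [ae_all_iff.2 h1] with ω hω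
  exact hω _ rfl

/-- The expected first-order regret bound of MYGA against a linear classifier. -/
theorem learnerLoss_le_policyLoss
    (h : IsBanditInteraction T D μ X θ A (mygaLearner T η γ β X θ A))
    (hloss : ∀ t < T, ∀ i, ∀ᵐ ω ∂μ, banditLoss X θ t ω i ∈ Set.Icc (0 : ℝ) 1)
    (hT : 0 < T) (hη : 0 < η) (hγ : γ = 2 * η)
    (hγT : 1 / (2 * T) ≤ γ) (hKη : K * η ≤ 1 / 20) (j : Fin N) :
    learnerLoss T μ X θ A ≤ (1 + 18 * (K * η)) *
      (policyLoss T μ X θ (linClassifier (β j)) + 2 * (Real.log (N + T) / η)) := by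
  have hγ0 : 0 < γ := by linarith
  have hK : (0 : ℝ) < K := by exact_mod_cast NeZero.pos K
  have hest := fun t (ht : t ∈ Finset.range T) =>
    h.integral_advice_mul_div_le hloss (lt_min hγ0 (by positivity : 0 < 1 / (2 * (K : ℝ))))
      (fun t ω i => by
        obtain ⟨M, q, hq, he⟩ := isMajorityMix_mygaLearner (T := T) (η := η) (γ := γ) (X := X)
          (θ := θ) (A := A) (β := β) t ω
        rw [he]
        exact ⟨hq.truncArms_nonneg γ i, hq.min_le_of_truncArms_pos⟩) (Finset.mem_range.1 ht) (β j)
  have hall : ∀ᵐ ω ∂μ, ∀ t ∈ Finset.range T, (∀ i, banditLoss X θ t ω i ∈ Set.Icc (0 : ℝ) 1) ∧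
      0 < mygaLearner T η γ β X θ A t ω (A t ω) :=
    (ae_ball_iff (Set.to_countable _)).2 fun t ht => by
      have ht := Finset.mem_range.1 ht
      filter_upwards [ae_all_iff.2 (hloss t ht), mygaLearner_pos_ae h ht] with ω h1 h2
        using ⟨h1, h2⟩
  have hi1 := integrable_finsetSum (Finset.range T) fun t ht => (hest t ht).1
  calc learnerLoss T μ X θ A
      ≤ ∫ ω, (1 + 18 * (K * η)) * (∑ t ∈ Finset.range T,
          classifierAdvice (β j) (X t ω) (A t ω) *
          (banditLoss X θ t ω (A t ω) / mygaLearner T η γ β X θ A t ω (A t ω)) +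
          2 * (Real.log (N + T) / η)) ∂μ := by
        refine integral_mono_ae (integrable_finsetSum _ fun t ht => h.integrable_loss hloss
          (Finset.mem_range.1 ht) (h.measurable_arm t (Finset.mem_range.1 ht)))
          ((hi1.add (integrable_const _)).const_mul _) ?_
        filter_upwards [hall] with ω hω
        exact sum_loss_le_of_mygaProb_pos (T := T) (η := η) (γ := γ)
          (ξ := fun s j => classifierAdvice (β j) (X s ω)) (A := fun s => A s ω)
          (y := fun s => banditLoss X θ s ω (A s ω)) hT hη hγ hγT hKη
          (fun _ _ _ => classifierAdvice_nonneg _ _ _) (fun _ _ => sum_classifierAdvice _ _)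
          (fun t ht => (hω t (Finset.mem_range.2 ht)).1 _)
          (fun t ht => (hω t (Finset.mem_range.2 ht)).2) j
    _ = (1 + 18 * (K * η)) * (∑ t ∈ Finset.range T, ∫ ω,
          classifierAdvice (β j) (X t ω) (A t ω) *
          (banditLoss X θ t ω (A t ω) / mygaLearner T η γ β X θ A t ω (A t ω)) ∂μ +
          2 * (Real.log (N + T) / η)) := by
        rw [integral_const_mul, integral_add hi1 (integrable_const _),
          integral_finsetSum _ fun t ht => (hest t ht).1]
        simp
    _ ≤ _ := by
        refine mul_le_mul_of_nonneg_left (add_le_add ?_ le_rfl) (by positivity)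
        rw [policyLoss, integral_finsetSum]
        swap
        · intro t ht
          exact h.integrable_loss hloss (Finset.mem_range.1 ht)
            ((measurable_linClassifier (β j)).comp
              (h.measurable_context t (Finset.mem_range.1 ht)))
        exact Finset.sum_le_sum fun t ht => (hest t ht).2

end Regret

/-! ### Tuning of the learning rate. -/

section Rate

variable {K T N : ℕ} {L : ℝ}

theorem mygaRate_eq {a : ℝ} : mygaRate a K T N L = a * mygaRate 1 K T N L := by
  rw [mygaRate, mygaRate, one_mul]

variable [NeZero K]

/-- The rate without the absolute constant, characterized by its square. -/
theorem mygaRate_one_spec (hΛ : 0 < Real.log (N + T)) :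
    0 < mygaRate 1 K T N L ∧
      mygaRate 1 K T N L ^ 2 * (K * max L (K * Real.log (N + T))) = Real.log (N + T) := by
  have hK : (0 : ℝ) < K := by exact_mod_cast NeZero.pos K
  have hm : 0 < max L (K * Real.log (N + T)) := lt_max_of_lt_right (by positivity)
  rw [mygaRate, one_mul]
  refine ⟨Real.sqrt_pos.2 (by positivity), ?_⟩
  rw [Real.sq_sqrt (by positivity)]
  field_simp

theorem mul_mygaRate_one_le (hΛ : 0 < Real.log (N + T)) : K * mygaRate 1 K T N L ≤ 1 := by
  obtain ⟨h0, h1⟩ := mygaRate_one_spec (K := K) (L := L) hΛ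
  have hK : (0 : ℝ) < K := by exact_mod_cast NeZero.pos K
  set r := mygaRate 1 K T N L
  have h2 : r ^ 2 * (K * (K * Real.log (N + T))) ≤ Real.log (N + T) := by
    conv_rhs => rw [← h1]
    gcongr
    exact le_max_right _ _
  have h3 : (K * r) ^ 2 ≤ 1 := by
    refine le_of_mul_le_mul_right (a := Real.log (N + T)) ?_ hΛ
    linarith
  exact (sq_le_one_iff₀ (by positivity)).1 h3

/-- With `Λ` the logarithm, the left side is the square root of `Λ * (K * max L (K * Λ))`, and the
maximum is at most the sum. -/
theorem log_div_mygaRate_one_le (hΛ : 0 < Real.log (N + T)) (hL : 0 ≤ L) :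
    Real.log (N + T) / mygaRate 1 K T N L ≤
      Real.sqrt (K * L * Real.log (N + T)) + K * Real.log (N + T) := by
  obtain ⟨h0, h1⟩ := mygaRate_one_spec (K := K) (L := L) hΛ
  have hK : (0 : ℝ) < K := by exact_mod_cast NeZero.pos K
  set r := mygaRate 1 K T N L
  set Λ := Real.log (N + T)
  have hm : max L (K * Λ) ≤ L + K * Λ := max_le (by linarith [mul_pos hK hΛ]) (by linarith)
  have hs := Real.sq_sqrt (by positivity : 0 ≤ K * L * Λ)
  have h2 : (Λ / r) ^ 2 = Λ * (K * max L (K * Λ)) := by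
    rw [div_pow, div_eq_iff (by positivity)]
    linear_combination (-Λ) * h1
  have h3 : Λ * (K * max L (K * Λ)) ≤ Λ * (K * (L + K * Λ)) := by gcongr
  refine (pow_le_pow_iff_left₀ (by positivity) (by positivity) two_ne_zero).1 ?_
  have h4 : 0 ≤ Real.sqrt (K * L * Λ) * (K * Λ) := by positivity
  nlinarith

theorem mul_mygaRate_one_mul_le (hΛ : 0 < Real.log (N + T)) (hL : 0 ≤ L) :
    K * mygaRate 1 K T N L * L ≤ Real.sqrt (K * L * Real.log (N + T)) := by
  obtain ⟨h0, h1⟩ := mygaRate_one_spec (K := K) (L := L) hΛ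
  have hK : (0 : ℝ) < K := by exact_mod_cast NeZero.pos K
  set r := mygaRate 1 K T N L
  refine Real.le_sqrt_of_sq_le ?_
  have h2 : r ^ 2 * (K * L) ≤ Real.log (N + T) := by
    conv_rhs => rw [← h1]
    gcongr
    exact le_max_left _ _
  have h3 := mul_le_mul_of_nonneg_left h2 (by positivity : 0 ≤ K * L)
  linarith

end Rate

/-! ### Size of the cover and the final bound. -/

/-- The logarithm of the number of experts of a cover. -/
theorem log_add_le_of_card_le {K d T N : ℕ} [NeZero K] [NeZero d] {R : ℝ} (hR : 0 < R)
    (hT : 2 ≤ T) (hN : (N : ℝ) ≤ (max 1 (6 * R * T / ((K : ℝ) ^ 2 * d))) ^ (K * d))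
    (hN0 : 0 < N) :
    Real.log (N + T) ≤ (2 + 2 * Real.log (max 1 (6 * R))) * (K * d * Real.log T) := by
  have hT' : (2 : ℝ) ≤ T := by exact_mod_cast hT
  have hN0' : (0 : ℝ) < N := by exact_mod_cast hN0
  have hn : 1 ≤ K * d := Nat.mul_pos (NeZero.pos K) (NeZero.pos d)
  have hKd : (1 : ℝ) ≤ (K : ℝ) ^ 2 * d := by
    have : 1 ≤ K ^ 2 * d := Nat.mul_pos (pow_pos (NeZero.pos K) 2) (NeZero.pos d)
    exact_mod_cast this
  set B := max 1 (6 * R) with hB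
  have hB1 : 1 ≤ B := le_max_left _ _
  have hBT : T ≤ B * T := le_mul_of_one_le_left (by positivity) hB1
  have h1 : (N : ℝ) ≤ (B * T) ^ (K * d) := by
    refine hN.trans (pow_le_pow_left₀ (by positivity) (max_le (by linarith) ?_) _)
    calc 6 * R * T / ((K : ℝ) ^ 2 * d) ≤ 6 * R * T := div_le_self (by positivity) hKd
      _ ≤ B * T := mul_le_mul_of_nonneg_right (le_max_right _ _) (by positivity)
  have h2 : (T : ℝ) ≤ (B * T) ^ (K * d) :=
    hBT.trans (le_self_pow₀ (by linarith) (by omega))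
  -- Both summands are at most the power, and the factor `2` is absorbed by `T ≥ 2`.
  have h3 : (N + T : ℝ) ≤ T * (B * T) ^ (K * d) := by nlinarith
  have hlogT : 1 / 2 ≤ Real.log T := by
    have := Real.log_le_log two_pos hT'
    linarith [Real.log_two_gt_d9]
  have hlogB : 0 ≤ Real.log B := Real.log_nonneg hB1
  have hn' : (1 : ℝ) ≤ K * d := by exact_mod_cast hn
  calc Real.log (N + T) ≤ Real.log (T * (B * T) ^ (K * d)) :=
        Real.log_le_log (by positivity) h3
    _ = Real.log T + K * d * (Real.log B + Real.log T) := by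
        rw [Real.log_mul (by positivity) (by positivity), Real.log_pow,
          Real.log_mul (by positivity) (by positivity)]
        push_cast
        ring
    _ ≤ K * d * Real.log T + K * d * (2 * Real.log B * Real.log T + Real.log T) := by
        have h4 : Real.log B ≤ 2 * Real.log B * Real.log T := by nlinarith
        have h5 : Real.log T ≤ K * d * Real.log T := le_mul_of_one_le_left (by linarith) hn'
        gcongr
    _ = _ := by ring

/-- The regret of MYGA on a cover, in terms of the number of experts. -/
theorem expectedRegret_le_log {Ω : Type*} [MeasurableSpace Ω] {K d T N : ℕ} [NeZero K]
    {μ : Measure Ω} [IsProbabilityMeasure μ]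
    {D : Measure (EuclideanSpace ℝ (Fin d))} {X : ℕ → Ω → EuclideanSpace ℝ (Fin d)}
    {θ : ℕ → Ω → Fin K → EuclideanSpace ℝ (Fin d)} {A : ℕ → Ω → Fin K}
    {β : Fin N → Fin K → EuclideanSpace ℝ (Fin d)} {σ R L ε : ℝ} (hT : 2 ≤ T)
    (hσ0 : 0 ≤ σ) (hε : 0 ≤ ε) (hβ : IsParamCover (R * T) ε β)
    (h : IsBanditInteraction T D μ X θ A (mygaLearner T (mygaRate (1 / 20) K T N L)
      (2 * mygaRate (1 / 20) K T N L) β X θ A))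
    (hσ : ∀ᵐ x ∂D, ‖x‖ ≤ σ) (hR : ∀ t < T, ∀ i, ∀ᵐ ω ∂μ, ‖θ t ω i‖ ≤ R)
    (hloss : ∀ t < T, ∀ i, ∀ᵐ ω ∂μ, banditLoss X θ t ω i ∈ Set.Icc (0 : ℝ) 1)
    (hL : optLoss T μ X θ ≤ L) :
    expectedRegret T μ X θ A ≤ 4 * σ * ε +
      77 * (Real.sqrt (K * L * Real.log (N + T)) + K * Real.log (N + T)) := by
  have hT' : (2 : ℝ) ≤ T := by exact_mod_cast hT
  have hK : (0 : ℝ) < K := by exact_mod_cast NeZero.pos K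
  obtain ⟨j, hj⟩ := h.exists_linClassifier_policyLoss_le (by omega) hσ hR hloss hβ
  have : NeZero N := ⟨(j.pos).ne'⟩
  have hopt := optLoss_nonneg hloss
  have hL0 : 0 ≤ L := hopt.trans hL
  have hΛ : 1 / 2 ≤ Real.log (N + T) := by
    have h1 : (2 : ℝ) ≤ N + T := by linarith [(Nat.cast_nonneg N : (0 : ℝ) ≤ N)]
    linarith [Real.log_le_log two_pos h1, Real.log_two_gt_d9]
  have hΛ0 : 0 < Real.log (N + T) := by linarith
  have h1 := (mygaRate_one_spec (K := K) (L := L) hΛ0).1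
  have h2 := mul_mygaRate_one_le (K := K) (L := L) hΛ0
  have h3 := log_div_mygaRate_one_le (K := K) hΛ0 hL0
  have h4 := mul_mygaRate_one_mul_le (K := K) hΛ0 hL0
  rw [mygaRate_eq (a := 1 / 20)] at h
  set r := mygaRate 1 K T N L
  set Λ := Real.log (N + T)
  set s := Real.sqrt (K * L * Λ)
  have hs : 0 ≤ s := Real.sqrt_nonneg _
  have hlogdiv : Λ / (1 / 20 * r) = 20 * (Λ / r) := by
    field_simp
  have hσε : 0 ≤ σ * ε := by positivity
  have hKΛ : 0 < K * Λ := by positivity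
  rw [expectedRegret]
  -- If `γ` is below the grid step, then `r * T < 5`, and the trivial bound `T` on the loss is
  -- already at most `20 * (Λ / r)`.
  rcases le_or_gt (1 / (2 * (T : ℝ))) (2 * (1 / 20 * r)) with hγ | hγ
  · have hreg := learnerLoss_le_policyLoss h hloss (by omega) (by positivity) rfl hγ
      (by linarith) j
    rw [hlogdiv] at hreg
    have hu : K * (1 / 20 * r) = K * r / 20 := by ring
    rw [hu] at hreg
    have h5 : 0 ≤ K * r := by positivity
    have h6 : 0 ≤ Λ / r := by positivity
    have h7 : (1 + 18 * (K * r / 20)) * (policyLoss T μ X θ (linClassifier (β j)) +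
        2 * (20 * (Λ / r))) ≤ (1 + 18 * (K * r / 20)) *
        ((optLoss T μ X θ + 2 * σ * ε) + 2 * (20 * (Λ / r))) := by gcongr
    have h8 : K * r * optLoss T μ X θ ≤ s := (mul_le_mul_of_nonneg_left hL h5).trans h4
    have h9 : K * r * (2 * σ * ε) ≤ 2 * σ * ε := mul_le_of_le_one_left (by positivity) h2
    have h10 : K * r * (Λ / r) ≤ Λ / r := mul_le_of_le_one_left h6 h2
    -- The coefficient of `Λ / r` is `40 + 36 = 76`, that of `σ * ε` is `3.8`, and `K * r * optLoss`
    -- adds at most `0.9 * s`; this gives `77` and `4`.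
    linarith
  · have hle := h.learnerLoss_le hloss
    rw [lt_div_iff₀ (by positivity)] at hγ
    have h5 : (T : ℝ) ≤ 20 * (Λ / r) := by
      rw [mul_div_assoc', le_div_iff₀ h1]
      linarith
    linarith

theorem theorem1 :
    -- absolute constants of the tuning of the algorithm
    ∃ a b : ℝ, 0 < a ∧ 0 < b ∧
    ∀ σ R : ℝ, 0 < σ → 0 < R →
    -- the constant in the regret bound depends on the norm bounds `σ` and `R` only
    ∃ C : ℝ, 0 < C ∧
    ∀ (K d T : ℕ) [NeZero K] [NeZero d], 2 ≤ T →
      -- there is a cover with `Θ(T / (K² d)) ^ (K d)` elements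
      (∃ (N : ℕ) (β : Fin N → Fin K → EuclideanSpace ℝ (Fin d)),
        IsParamCover (R * T) ((K : ℝ) ^ 2 * d / 2) β ∧
        (2 * R * T / ((K : ℝ) ^ 2 * d)) ^ (K * d) ≤ (N : ℝ) ∧
        (N : ℝ) ≤ (max 1 (6 * R * T / ((K : ℝ) ^ 2 * d))) ^ (K * d)) ∧
      -- on every such cover, the algorithm has the first-order regret bound
      ∀ (N : ℕ) (β : Fin N → Fin K → EuclideanSpace ℝ (Fin d)),
        IsParamCover (R * T) ((K : ℝ) ^ 2 * d / 2) β →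
        (N : ℝ) ≤ (max 1 (6 * R * T / ((K : ℝ) ^ 2 * d))) ^ (K * d) →
        ∀ (L : ℝ) (Ω : Type*) [MeasurableSpace Ω] (μ : Measure Ω) [IsProbabilityMeasure μ]
          (D : Measure (EuclideanSpace ℝ (Fin d)))
          (X : ℕ → Ω → EuclideanSpace ℝ (Fin d))
          (θ : ℕ → Ω → Fin K → EuclideanSpace ℝ (Fin d)) (A : ℕ → Ω → Fin K),
          IsBanditInteraction T D μ X θ A
            (mygaLearner T (mygaRate a K T N L) (b * mygaRate a K T N L) β X θ A) →
          (∀ᵐ x ∂D, ‖x‖ ≤ σ) →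
          (∀ t < T, ∀ i, ∀ᵐ ω ∂μ, ‖θ t ω i‖ ≤ R) →
          (∀ t < T, ∀ i, ∀ᵐ ω ∂μ, banditLoss X θ t ω i ∈ Set.Icc (0 : ℝ) 1) →
          optLoss T μ X θ ≤ L →
          expectedRegret T μ X θ A ≤
            C * (K * Real.sqrt (d * L * Real.log T) + (K : ℝ) ^ 2 * d * Real.log T) := by
  refine ⟨1 / 20, 2, by norm_num, by norm_num, fun σ R hσ0 hR0 => ?_⟩
  have hlogB : 0 ≤ Real.log (max 1 (6 * R)) := Real.log_nonneg (le_max_left _ _)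
  set C₁ := 2 + 2 * Real.log (max 1 (6 * R)) with hC₁
  have hC₁1 : 1 ≤ C₁ := by linarith
  -- The term `4 * σ` pays for the cover radius, using `log T ≥ 1 / 2`; the term `77 * C₁` pays for
  -- the regret against the experts.
  refine ⟨4 * σ + 77 * C₁, by positivity, ?_⟩
  intro K d T _ _ hT
  have hT' : (2 : ℝ) ≤ T := by exact_mod_cast hT
  have hK : (0 : ℝ) < K := by exact_mod_cast NeZero.pos K
  have hd : (0 : ℝ) < d := by exact_mod_cast NeZero.pos d
  constructor
  · obtain ⟨N, β, h1, h2, h3⟩ := exists_isParamCover (K := K) (d := d) (ρ := R * T)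
      (ε := (K : ℝ) ^ 2 * d / 2) (by positivity) (by positivity)
    refine ⟨N, β, h1, ?_, ?_⟩
    · convert h2 using 2
      field_simp
    · convert h3 using 3
      field_simp
      norm_num
  · intro N β hβ hN L Ω _ μ _ D X θ A h hσ hR hloss hL
    have hreg := expectedRegret_le_log hT hσ0.le (by positivity) hβ h hσ hR hloss hL
    -- A cover is nonempty because it must cover `0`.
    have hN0 : 0 < N := by
      obtain ⟨j, -⟩ := hβ 0 fun a => by
        rw [Pi.zero_apply, norm_zero]
        positivity
      exact j.pos
    have hΛ := log_add_le_of_card_le hR0 hT hN hN0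
    have hL0 : 0 ≤ L := (optLoss_nonneg hloss).trans hL
    have hlogT : 1 / 2 ≤ Real.log T := by
      linarith [Real.log_le_log two_pos hT', Real.log_two_gt_d9]
    have hlogT0 : 0 < Real.log T := by linarith
    rw [← hC₁] at hΛ
    have h1 : K * Real.log (N + T) ≤ C₁ * ((K : ℝ) ^ 2 * d * Real.log T) :=
      (mul_le_mul_of_nonneg_left hΛ hK.le).trans (by linarith)
    have h2 : Real.sqrt (K * L * Real.log (N + T)) ≤
        C₁ * (K * Real.sqrt (d * L * Real.log T)) := by
      refine Real.sqrt_le_iff.2 ⟨by positivity, ?_⟩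
      rw [mul_pow, mul_pow, Real.sq_sqrt (by positivity)]
      have h3 := mul_le_mul_of_nonneg_left hΛ (by positivity : 0 ≤ K * L)
      have h4 : 0 ≤ (K : ℝ) ^ 2 * (d * L * Real.log T) := by positivity
      -- Since `C₁ ≥ 1`, the constant may leave the square root as `C₁` itself.
      have h5 : C₁ ≤ C₁ ^ 2 := by nlinarith
      have h6 := mul_le_mul_of_nonneg_right h5 h4
      linarith
    have h3 : 4 * σ * ((K : ℝ) ^ 2 * d / 2) ≤ 4 * σ * ((K : ℝ) ^ 2 * d * Real.log T) := by
      refine mul_le_mul_of_nonneg_left ?_ (by positivity)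
      rw [div_eq_mul_one_div]
      exact mul_le_mul_of_nonneg_left hlogT (by positivity)
    have h4 : 0 ≤ 4 * σ * (K * Real.sqrt (d * L * Real.log T)) := by positivity
    linarith
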